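/- Let $F_0=1$, $F_1=2$, $F_{n+2}=F_{n+1}+F_n$. Every $n\in\mathbb N$ has a unique expansion $n=\sum_{i=0}^k b_iF_i$ with $b_i\in\{0,1\}$, $b_ib_{i+1}=0$ and no leading zero; write $(n)_Z=b_k\cdots b_0$ (the empty word for $n=0$), and for a word $w=w_k\cdots w_0$ over $\{0,1\}$ write $[w]_Z=\sum_i w_iF_i$. Words are read from left to right (most significant digit first). Put $\phi(n)=[(n)_Z0]_Z$ and $\delta(m,n)=\phi(m+n)-\phi(m)-\phi(n)$. Let $\varphi=\frac{1+\sqrt5}{2}$. For words $u,v$, let $u\boxminus v$ be their digitwise difference, a word over $\{-1,0,1\}$, the shorter word being padded with leading zeros. Let $R$ be a commutative ring and let $\Phi\colon R[[x]]\to R[[x]]$, $\Phi(\sum_n f_nx^n)=\sum_n f_nx^{\phi(n)}$. A Z-Mahler equation of exponent $d$ is an equation $P(x,y)=\sum_{i=0}^dA_i(x)\Phi^i(y)=0$ with $A_i\in R[x]$; its height $h$ is the maximum of the degrees of $A_0,\dots,A_d$; it is isolating if $A_0=1$, and then we write it $y=\sum_{i=1}^d\bigl(\sum_{j=0}^h\alpha_{i,j}x^j\bigr)\Phi^i(y)$.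 A weighted automaton has a finite state set $S$, initial and final weights $I,F\colon S\to R$ and a weight in $R$ for each transition $s\xrightarrow{b}s'$; $\mathrm{weight}(w)$ is the sum, over all paths labelled $w$, of the product of the initial weight, the transition weights and the final weight. A series $f=\sum_n f_nx^n$ is Z-regular if some weighted automaton over $\{0,1\}$ satisfies $\mathrm{weight}((n)_Z)=f_n$ for all $n$. A deterministic automaton with output generates $f$ if its output after reading $(n)_Z$ is $f_n$ for all $n$. There is a finite deterministic automaton $\mathcal D$ over $\{-1,0,1\}$ (possibly with missing transitions) with state set $Q$, initial state $q_0$, transition function $\Gamma$ and output function $\tau\colon Q\to\{-1,0,1\}$, such that $\Gamma(q_0,0)=q_0$ and $\tau(\Gamma(q_0,(m)_Z\boxminus(n)_Z))=\delta(m-n,n)$ for all $m\ge n\ge0$. For any such $\mathcal D$, any isolating Z-Mahler equation $P$ of exponent $d$ and height $h$ and any $f_0\in R$, put $\tilde h=\bigl\lfloor\frac{h+3-\varphi}{\varphi-1}\bigr\rfloor$ and $g=|(\tilde h)_Z|$, and let $\mathcal A(P,f_0)$ be the weighted automaton over $\{0,1\}$ with states $s_{i,j,q,u}$ ($0\le i\le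 d$, $0\le j\le\tilde h$, $q\in Q$, $u\in\{0,1\}^g$), whose non-zero transitions are, for $0\le i\le d-1$, $a,b\in\{0,1\}$, $u\in\{0,1\}^{g-1}$ and $\ell=\phi(j)+\tau(\Gamma(q,au\boxminus(j)_Z))+b$, $$s_{i,j,q,au}\xrightarrow{\,b\,:\,1\,}s_{i+1,\ell,\Gamma(q,a),ub}\ \ (0\le\ell\le\tilde h),\qquad s_{i,j,q,au}\xrightarrow{\,b\,:\,\alpha_{i+1,\ell-k}\,}s_{0,k,\Gamma(q,a),ub}\ \ (0\le k\le\tilde h,\ 0\le\ell-k\le h),$$ whenever the values of $\Gamma$ used are defined, with $I(s_{i,0,q_0,0^g})=f_0$, $F(s_{0,0,q,u})=1$ for all $i,q,u$, and all other initial and final weights $0$. Theorem. Let $P$ be an isolating Z-Mahler equation over $R$ of exponent $d$ and height $h$, and let $f=\sum_n f_nx^n\in R[[x]]$ be a solution of $P$. Then $\mathcal A(P,f_0)$ satisfies $\mathrm{weight}(w)=f_{[w]_Z}$ for every word $w\in\{0,1\}^*$ without two consecutive digits $1$. In particular $f$ is Z-regular. If moreover $R$ is finite and $h\ge1$, then $f$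 is generated by a deterministic automaton with at most $|R|^{320\,d\,h^2}$ states. -/

import Mathlib

namespace ZMahler

/-! ### The Zeckendorf numeration

Words are lists written with the most significant digit first; the digit alphabet is `{0, 1} = Fin 2`.
The Fibonacci numbers of the numeration are `F_i = Nat.fib (i + 2)`, i.e. `1, 2, 3, 5, …`. -/

/-- `[w]_Z = ∑ i, w_i F_i` for a word `w = w_k ⋯ w_0` over `{0, 1}`. -/
def zval : List (Fin 2) → ℕ
  | [] => 0
  | b :: w => (b : ℕ) * Nat.fib (w.length + 2) + zval w

/-- The canonical expansion `(n)_Z` of `n`, without leading zeros (so `(0)_Z` is the empty word).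
`Nat.zeckendorf n` is the decreasing list of the indices `m ≥ 2` such that `Nat.fib m` occurs in the
Zeckendorf decomposition of `n`, hence the digit of `F_i` is `1` iff `i + 2` belongs to it. -/
def zrep (n : ℕ) : List (Fin 2) :=
  (List.range ((Nat.zeckendorf n).headD 1 - 1)).reverse.map
    fun i => if i + 2 ∈ Nat.zeckendorf n then 1 else 0

/-- The word `w` has no two consecutive digits `1`. -/
def NoConsecutiveOnes (w : List (Fin 2)) : Prop :=
  w.IsChain fun a b => ¬(a = 1 ∧ b = 1)

/-- The function `ϕ(n) = [(n)_Z 0]_Z`. -/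
def phi (n : ℕ) : ℕ := zval (zrep n ++ [0])

/-- The linearity defect `δ(m, n) = ϕ(m + n) - ϕ(m) - ϕ(n)`. -/
def defect (m n : ℕ) : ℤ := (phi (m + n) : ℤ) - phi m - phi n

/-- The difference `a - b` of two digits, in the alphabet `{-1, 0, 1}`, which is represented by `SignType`. -/
def digitSub (a b : Fin 2) : SignType := if a = b then 0 else if b = 0 then 1 else -1

/-- The digitwise difference `u ⊟ v`; the shorter word is padded with leading zeros. -/
def wordSub (u v : List (Fin 2)) : List SignType :=
  List.zipWith digitSub (u.leftpad v.length 0) (v.leftpad u.length 0)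

/-! ### Automata -/

/-- A deterministic automaton with output, with states in `S`, input alphabet `B` and output alphabet
`A`. Some transitions may be missing (`step s b = none`). -/
structure DetAutomaton (S B A : Type*) where
  step : S → B → Option S
  start : S
  out : S → A

/-- The state reached from `s` after reading the word `w`, if the needed transitions exist. -/
def DetAutomaton.run {S B A : Type*} (D : DetAutomaton S B A) (s : S) (w : List B) : Option S :=
  w.foldlM D.step s

/-- The output after reading the word `w` from the state `s`. -/
def DetAutomaton.output {S B A : Type*} (D : DetAutomaton S B A) (s : S) (w : List B) : Option A :=
  (D.run s w).map D.out

/-- A deterministic automaton generates the series `f` if its output on `(n)_Z` is the coefficient of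
`x ^ n` in `f`, for every `n`. -/
def DetAutomaton.Generates {S R : Type*} [CommRing R] (D : DetAutomaton S (Fin 2) R)
    (f : PowerSeries R) : Prop :=
  ∀ n : ℕ, D.output D.start (zrep n) = some (PowerSeries.coeff n f)

/-- A weighted automaton with states in `S`, alphabet `B` and weights in `R`; `trans s b s'` is the
weight of the transition from `s` to `s'` labelled `b`. -/
structure WeightedAutomaton (S B R : Type*) where
  trans : S → B → S → R
  init : S → R
  final : S → R

/-- The weight of a word `w = b_1 ⋯ b_n`: the sum, over all paths `γ_0, …, γ_n` of states, of the
product of the initial weight of `γ_0`, of the weights of the transitions `γ_k → γ_{k+1}` labelled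
`b_{k+1}`, and of the final weight of `γ_n`. -/
def WeightedAutomaton.weight {S B R : Type*} [Fintype S] [CommRing R]
    (A : WeightedAutomaton S B R) (w : List B) : R :=
  ∑ γ : Fin (w.length + 1) → S,
    A.init (γ 0) * (∏ k : Fin w.length, A.trans (γ k.castSucc) (w.get k) (γ k.succ)) *
      A.final (γ (Fin.last w.length))

/-- The series `f` is Z-regular: some weighted automaton with finitely many states gives to `(n)_Z`
the coefficient of `x ^ n` in `f` as its weight, for every `n`. -/
def IsZRegular {R : Type*} [CommRing R] (f : PowerSeries R) : Prop :=
  ∃ (S : Type) (_ : Fintype S) (A : WeightedAutomaton S (Fin 2) R),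
    ∀ n : ℕ, A.weight (zrep n) = PowerSeries.coeff n f

/-! ### Z-Mahler equations -/

/-- The Z-Mahler operator `Φ(∑ f_n x ^ n) = ∑ f_n x ^ ϕ(n)`: the coefficient of `x ^ m` is the sum of
the `f_n` with `ϕ(n) = m`. -/
noncomputable def Phi {R : Type*} [CommRing R] (f : PowerSeries R) : PowerSeries R :=
  PowerSeries.mk fun m => ∑ᶠ n ∈ {n : ℕ | phi n = m}, PowerSeries.coeff n f

/-- A Z-Mahler equation `∑_{i=0}^d A_i(x) Φ^i(y) = 0` of exponent `d` with `A_i = coeff i ∈ R[x]`. -/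
structure ZMahlerEquation (R : Type*) [CommRing R] where
  exponent : ℕ
  coeff : Fin (exponent + 1) → Polynomial R

namespace ZMahlerEquation

variable {R : Type*} [CommRing R]

/-- The height: the maximal degree of the coefficients. -/
noncomputable def height (P : ZMahlerEquation R) : ℕ :=
  Finset.univ.sup fun i => (P.coeff i).natDegree

/-- The equation is isolating: `A_0 = 1`. -/
def IsIsolating (P : ZMahlerEquation R) : Prop := P.coeff 0 = 1

/-- `f` is a solution of the equation. -/
def IsSolution (P : ZMahlerEquation R) (f : PowerSeries R) : Prop :=
  ∑ i : Fin (P.exponent + 1), (P.coeff i : PowerSeries R) * Phi^[(i : ℕ)] f = 0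

/-- The coefficients `α_{i,j}` of an isolating equation in the form
`y = ∑_{i=1}^d (∑_j α_{i,j} x ^ j) Φ^i(y)`, extended by `0` for `i > d`
(only the values at `i ≥ 1` are used). -/
noncomputable def alpha (P : ZMahlerEquation R) (i j : ℕ) : R :=
  if hi : i < P.exponent + 1 then -(P.coeff ⟨i, hi⟩).coeff j else 0

/-- The bound `h̃ = ⌊(h + 3 - φ) / (φ - 1)⌋`, with `φ` the golden ratio. -/
noncomputable def hTilde (P : ZMahlerEquation R) : ℕ :=
  ⌊((P.height : ℝ) + 3 - Real.goldenRatio) / (Real.goldenRatio - 1)⌋₊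

/-- The length `g = |(h̃)_Z|`. -/
noncomputable def gLen (P : ZMahlerEquation R) : ℕ := (zrep P.hTilde).length

/-- The states `s_{i,j,q,u}` with `0 ≤ i ≤ d`, `0 ≤ j ≤ h̃`, `q ∈ Q` and `u ∈ {0,1}^g`. -/
abbrev State (P : ZMahlerEquation R) (Q : Type*) : Type _ :=
  Fin (P.exponent + 1) × Fin (P.hTilde + 1) × Q × List.Vector (Fin 2) P.gLen

end ZMahlerEquation

/-- The automaton computes the linearity defect: it has a loop labelled `0` at its initial state, and
its output on `(m)_Z ⊟ (n)_Z` is `δ(m - n, n)` for all `m ≥ n ≥ 0`. -/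
def DetAutomaton.ComputesDefect {Q : Type*} (D : DetAutomaton Q SignType SignType) : Prop :=
  D.step D.start 0 = some D.start ∧
    ∀ m n : ℕ, n ≤ m →
      (D.output D.start (wordSub (zrep m) (zrep n))).map (fun e : SignType => (e : ℤ)) =
        some (defect (m - n) n)

namespace ZMahlerEquation

variable {R : Type*} [CommRing R]

/-- `δ̂(s_{i,j,q,u}) = τ(Γ(q, u ⊟ (j)_Z))`, where `Γ` and `τ` are the transition function and the output
function of `D`. -/
noncomputable def deltaHat (P : ZMahlerEquation R) {Q : Type*} (D : DetAutomaton Q SignType SignType)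
    (s : P.State Q) : Option SignType :=
  D.output s.2.2.1 (wordSub s.2.2.2.toList (zrep (s.2.1 : ℕ)))

/-- The last two components of the states move from `(q, a u)` to `(Γ(q, a), u b)`
on reading `b`. -/
def Shift (P : ZMahlerEquation R) {Q : Type*} (D : DetAutomaton Q SignType SignType)
    (s : P.State Q) (b : Fin 2) (s' : P.State Q) : Prop :=
  ∃ (a : Fin 2) (u : List (Fin 2)), s.2.2.2.toList = a :: u ∧ s'.2.2.2.toList = u ++ [b] ∧
    D.step s.2.2.1 (digitSub a 0) = some s'.2.2.1

open Classical in
/-- The weight of the transition `s_{i,j,q,au} → s_{i',k,Γ(q,a),ub}` labelled `b`. With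
`ℓ = ϕ(j) + δ̂(s_{i,j,q,au}) + b`, it is `1` if `i' = i + 1` and `k = ℓ`,
it is `α_{i+1,ℓ-k}` if `i < d`, `i' = 0` and `0 ≤ ℓ - k ≤ h`, and all other transitions have weight `0`. -/
noncomputable def transWeight (P : ZMahlerEquation R) {Q : Type*}
    (D : DetAutomaton Q SignType SignType) (s : P.State Q) (b : Fin 2) (s' : P.State Q) : R :=
  match P.deltaHat D s with
  | none => 0
  | some e =>
    let i : ℕ := s.1
    let i' : ℕ := s'.1
    let k : ℤ := ((s'.2.1 : ℕ) : ℤ)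
    let l : ℤ := (phi (s.2.1 : ℕ) : ℤ) + (e : ℤ) + ((b : ℕ) : ℤ)
    if P.Shift D s b s' then
      if i' = i + 1 ∧ k = l then 1
      else if i < P.exponent ∧ i' = 0 ∧ 0 ≤ l - k ∧ l - k ≤ P.height then
        P.alpha (i + 1) (l - k).toNat
      else 0
    else 0

open Classical in
/-- The weighted automaton `𝒜(P, f₀)` associated to an isolating equation `P` and to `f₀ ∈ R`, built
with the automaton `D` computing the linearity defect. -/
noncomputable def automaton (P : ZMahlerEquation R) {Q : Type*}
    (D : DetAutomaton Q SignType SignType) (f₀ : R) : WeightedAutomaton (P.State Q) (Fin 2) R where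
  trans := P.transWeight D
  init := fun s =>
    if (s.2.1 : ℕ) = 0 ∧ s.2.2.1 = D.start ∧ s.2.2.2.toList = List.replicate P.gLen 0
    then f₀ else 0
  final := fun s => if (s.1 : ℕ) = 0 ∧ (s.2.1 : ℕ) = 0 then 1 else 0

end ZMahlerEquation

end ZMahler

/-!
The map `ϕ` is an almost linear function: if `φ` is the golden ratio and `ψ = 1 - φ`, then
`ϕ(n) - φ n = ∑ b_i ψ ^ (i + 2)` for the expansion `n = ∑ b_i F_i`, and this sum lies in the interval
`(φ - 2, φ - 1)` of length `1` (`phi_bounds`). Hence the linearity defect lies in `{-1, 0, 1}`.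

*The defect is computed by a finite automaton* (`exists_computesDefect`). For a signed word `w` of
value `n ≥ 0`, the defect is the difference of the values of `w0` and `z0`, where `z` is the expansion
of `n`. The automaton records, for all binary words `z` without two consecutive digits `1`, the
differences of the values of `w` and `z` and of `w0` and `z0`, as long as the former is at most `7`
in absolute value. The set of these pairs, with the last digits of the words `z`, is finite because the
conjugates are bounded, and it can be updated because the difference of the values is the expanding
direction: once it has left the box, it never returns.

*The weighted automaton.* Put `c_i(n, k) = [x ^ (n - k)] Φ^i(f)` (`shiftCoeff`). When a digit `b` is read
after a word of value `n`, the new value is `n' = ϕ(n) + b`, and `c_{i+1}(n', ℓ)` is `c_i(n, j)` if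
`n' - ℓ = ϕ(n - j)`, and `0` if there is no such `j` (`shiftCoeff_succ`). The bound `h̃` is stable: all
`ℓ ≤ h̃ + h` lead back to `j ≤ h̃` (`le_hTilde_of_phi_add_eq`). The equation expresses
`c_0(n', k)` by the `c_{i+1}(n', k + κ)` with `κ ≤ h` (`shiftCoeff_zero_eq`). The automaton performs this
recursion: the total weight of the paths with label `w` that end in `s_{i,j,q,u}` is `c_i([w]_Z, j)` for
the one pair `(q, u)` that is compatible with `w`, and `0` otherwise (`sum_stateWeight_mul_trans`).

*The deterministic automaton.* The recursion depends on `n` only through the differences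
`ϕ(n) - ϕ(n - j)` with `j ≤ min(h̃, n)`, and these differences satisfy a recursion of their own. So they form,
with the `c_i(n, j)` for `i < d` and `j ≤ h̃`, a right congruence with at most
`2 ^ ((h̃ + 1) (2 h̃ + 1)) |R| ^ (d (h̃ + 1))` classes (`profile_append_eq`), and `h̃ + 1 ≤ 5 h`.
-/

namespace ZMahler

/-! ### Words and their values -/

/-- The sum `∑ i, c(w_i) F_{i+s}` for a word `w = w_k ⋯ w_0` whose digits have the integer values `c`.
The shifts `s = 0` and `s = 1` give the value of `w` and the value of `w0`. -/
def fibSum {B : Type*} (c : B → ℤ) (s : ℕ) : List B → ℤ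
  | [] => 0
  | b :: w => c b * Nat.fib (w.length + 2 + s) + fibSum c s w

/-- The integer value of a binary digit. -/
def bitVal (b : Fin 2) : ℤ := (b : ℕ)

theorem fibSum_append_singleton {B : Type*} (c : B → ℤ) (s : ℕ) (w : List B) (b : B) :
    fibSum c s (w ++ [b]) = fibSum c (s + 1) w + c b * Nat.fib (s + 2) := by
  induction w with
  | nil => simp [fibSum, add_comm]
  | cons a w ih =>
    have h : w.length + 1 + 2 + s = w.length + 2 + (s + 1) := by ring
    simp [fibSum, ih, h, add_assoc]

theorem fibSum_add_two {B : Type*} (c : B → ℤ) (s : ℕ) (w : List B) :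
    fibSum c (s + 2) w = fibSum c (s + 1) w + fibSum c s w := by
  induction w with
  | nil => simp [fibSum]
  | cons a w ih =>
    have h : Nat.fib (w.length + 2 + (s + 2))
        = Nat.fib (w.length + 2 + s) + Nat.fib (w.length + 2 + (s + 1)) := by
      rw [← add_assoc, ← add_assoc, Nat.fib_add_two]
    simp only [fibSum, ih, h]
    push_cast
    ring

theorem coe_zval (w : List (Fin 2)) : (zval w : ℤ) = fibSum bitVal 0 w := by
  induction w with
  | nil => rfl
  | cons a w ih => simp [zval, fibSum, ih, bitVal]

theorem coe_zval_append_zero (w : List (Fin 2)) : (zval (w ++ [0]) : ℤ) = fibSum bitVal 1 w := by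
  rw [coe_zval, fibSum_append_singleton]
  simp [bitVal]

theorem zval_append_singleton (w : List (Fin 2)) (b : Fin 2) :
    zval (w ++ [b]) = zval (w ++ [0]) + b := by
  zify
  rw [coe_zval_append_zero, coe_zval, fibSum_append_singleton]
  simp [bitVal]

theorem zval_append_append_zero (w : List (Fin 2)) (b : Fin 2) :
    zval ((w ++ [b]) ++ [0]) = zval (w ++ [0]) + zval w + 2 * b := by
  zify
  rw [coe_zval_append_zero, coe_zval_append_zero, coe_zval, fibSum_append_singleton, fibSum_add_two]
  simp [bitVal, Nat.fib_add_two]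
  ring

theorem zval_replicate_append (k : ℕ) (w : List (Fin 2)) :
    zval (List.replicate k 0 ++ w) = zval w := by
  induction k with
  | zero => simp
  | succ k ih => simp [List.replicate_succ, zval, ih]

theorem noConsecutiveOnes_append_singleton {w : List (Fin 2)} {b : Fin 2} :
    NoConsecutiveOnes (w ++ [b]) ↔ NoConsecutiveOnes w ∧ ¬(w.getLast? = some 1 ∧ b = 1) := by
  unfold NoConsecutiveOnes
  rw [List.isChain_append]
  simp only [List.isChain_singleton, true_and, List.head?_cons, Option.mem_def, Option.some.injEq]
  constructor
  · rintro ⟨h, h'⟩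
    exact ⟨h, fun hb => h' 1 hb.1 b rfl ⟨rfl, hb.2⟩⟩
  · rintro ⟨h, h'⟩
    refine ⟨h, ?_⟩
    rintro x hx y rfl ⟨rfl, rfl⟩
    exact h' ⟨hx, rfl⟩

theorem NoConsecutiveOnes.of_append_left {u v : List (Fin 2)} (h : NoConsecutiveOnes (u ++ v)) :
    NoConsecutiveOnes u :=
  List.IsChain.left_of_append h

theorem NoConsecutiveOnes.of_append_right {u v : List (Fin 2)} (h : NoConsecutiveOnes (u ++ v)) :
    NoConsecutiveOnes v :=
  List.IsChain.right_of_append h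

theorem NoConsecutiveOnes.append_zero {w : List (Fin 2)} (h : NoConsecutiveOnes w) :
    NoConsecutiveOnes (w ++ [0]) :=
  noConsecutiveOnes_append_singleton.2 ⟨h, fun h => by simp at h⟩

theorem NoConsecutiveOnes.zero_cons {w : List (Fin 2)} (h : NoConsecutiveOnes w) :
    NoConsecutiveOnes (0 :: w) :=
  List.IsChain.cons h fun a _ h => by simp at h

theorem NoConsecutiveOnes.replicate_append {w : List (Fin 2)} (h : NoConsecutiveOnes w) (k : ℕ) :
    NoConsecutiveOnes (List.replicate k 0 ++ w) := by
  induction k with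
  | zero => simpa using h
  | succ k ih => simpa [List.replicate_succ] using ih.zero_cons

/-! ### Uniqueness of the expansion -/

/-- The decreasing list of the indices `i + 2`, for the positions `i` of the digits `1` of `w`. -/
def oneIndices : List (Fin 2) → List ℕ
  | [] => []
  | b :: w => if b = 1 then (w.length + 2) :: oneIndices w else oneIndices w

theorem lt_of_mem_oneIndices {w : List (Fin 2)} {i : ℕ} (h : i ∈ oneIndices w) :
    i < w.length + 2 := by
  induction w with
  | nil => simp [oneIndices] at h
  | cons b w ih =>
    simp only [oneIndices] at h
    split_ifs at h
    · rcases List.mem_cons.1 h with rfl | h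
      · simp
      · have := ih h
        simp only [List.length_cons]
        omega
    · have := ih h
      simp only [List.length_cons]
      omega

theorem sum_map_fib_oneIndices (w : List (Fin 2)) :
    ((oneIndices w).map Nat.fib).sum = zval w := by
  induction w with
  | nil => rfl
  | cons b w ih => fin_cases b <;> simp [oneIndices, zval, ih]

theorem isZeckendorfRep_oneIndices : ∀ {w : List (Fin 2)}, NoConsecutiveOnes w →
    (oneIndices w).IsZeckendorfRep
  | [], _ => by simp [oneIndices]
  | b :: w, h => by
    have ih := isZeckendorfRep_oneIndices (h.of_append_right (u := [b]))
    simp only [oneIndices]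
    split_ifs with hb
    · subst hb
      refine List.IsChain.cons ih fun a ha => ?_
      cases w with
      | nil => simp [oneIndices] at ha; simp [← ha]
      | cons c w =>
        have hc : c ≠ 1 := by
          rintro rfl
          exact (List.isChain_cons_cons.1 h).1 ⟨rfl, rfl⟩
        simp only [oneIndices, hc, if_false] at ha
        have ha' := List.mem_of_mem_head? ha
        rcases List.mem_append.1 ha' with h1 | h1
        · have := lt_of_mem_oneIndices h1
          simp only [List.length_cons]
          omega
        · simp at h1
          simp [h1]
    · exact ih

theorem zeckendorf_zval {w : List (Fin 2)} (h : NoConsecutiveOnes w) :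
    Nat.zeckendorf (zval w) = oneIndices w := by
  rw [← sum_map_fib_oneIndices, Nat.zeckendorf_sum_fib (isZeckendorfRep_oneIndices h)]

theorem map_mem_oneIndices (w : List (Fin 2)) :
    ((List.range w.length).reverse.map fun i => if i + 2 ∈ oneIndices w then (1 : Fin 2) else 0)
      = w := by
  induction w with
  | nil => rfl
  | cons b w ih =>
    have hlen : w.length + 2 ∉ oneIndices w := fun h => (lt_of_mem_oneIndices h).ne rfl
    rw [List.length_cons, List.range_succ, List.reverse_append, List.reverse_singleton,
      List.singleton_append, List.map_cons]
    congr 1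
    · fin_cases b <;> simp [oneIndices, hlen]
    · conv_rhs => rw [← ih]
      refine List.map_congr_left fun i hi => ?_
      have hi' : i ≠ w.length := by
        have := List.mem_range.1 (List.mem_reverse.1 hi)
        omega
      by_cases hb : b = 1 <;> simp [oneIndices, hb, hi']

theorem zrep_zval_one_cons {w : List (Fin 2)} (h : NoConsecutiveOnes (1 :: w)) :
    zrep (zval (1 :: w)) = 1 :: w := by
  have h1 : (oneIndices (1 :: w)).headD 1 - 1 = (1 :: w).length := by simp [oneIndices]
  rw [zrep, zeckendorf_zval h, h1]
  exact map_mem_oneIndices (1 :: w)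

theorem zrep_zero : zrep 0 = [] := by simp [zrep]

/-- Uniqueness of the expansion: a word without two consecutive digits `1` is the canonical
expansion of its value, up to leading zeros. -/
theorem exists_eq_replicate_append_zrep {w : List (Fin 2)} (h : NoConsecutiveOnes w) :
    ∃ k, w = List.replicate k 0 ++ zrep (zval w) := by
  induction w with
  | nil => exact ⟨0, by simp [zval, zrep_zero]⟩
  | cons b w ih =>
    rcases (by fin_cases b <;> simp : b = 0 ∨ b = 1) with rfl | rfl
    · obtain ⟨k, hk⟩ := ih (h.of_append_right (u := [0]))
      refine ⟨k + 1, ?_⟩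
      have h0 : zval (0 :: w) = zval w := by simp [zval]
      rw [h0, List.replicate_succ, List.cons_append, ← hk]
    · exact ⟨0, by simp [zrep_zval_one_cons h]⟩

theorem exists_zval_eq_of_lt : ∀ (k n : ℕ), n < Nat.fib (k + 2) →
    ∃ w, NoConsecutiveOnes w ∧ w.length = k ∧ zval w = n
  | 0, n, h => ⟨[], by simp [NoConsecutiveOnes], rfl, by simp at h; simp [zval, h]⟩
  | 1, n, h => by
    have h2 : n < 2 := h
    exact ⟨[⟨n, h2⟩], by simp [NoConsecutiveOnes], rfl, by simp [zval]⟩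
  | k + 2, n, h => by
    by_cases hn : n < Nat.fib (k + 1 + 2)
    · obtain ⟨w, h1, h2, h3⟩ := exists_zval_eq_of_lt (k + 1) n hn
      exact ⟨0 :: w, h1.zero_cons, by simp [h2], by simp [zval, h3]⟩
    · have hf : Nat.fib (k + 2 + 2) = Nat.fib (k + 2) + Nat.fib (k + 1 + 2) := Nat.fib_add_two
      obtain ⟨w, h1, h2, h3⟩ := exists_zval_eq_of_lt k (n - Nat.fib (k + 1 + 2)) (by omega)
      refine ⟨1 :: 0 :: w, List.IsChain.cons h1.zero_cons (by simp), by simp [h2], ?_⟩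
      have h4 : zval (1 :: 0 :: w) = Nat.fib (k + 1 + 2) + zval w := by simp [zval, h2]
      omega

theorem exists_zval_eq (n : ℕ) : ∃ w, NoConsecutiveOnes w ∧ zval w = n := by
  have h : n < Nat.fib (n + 5 + 2) := by
    have := Nat.le_fib_self (n := n + 5 + 2) (by omega)
    omega
  obtain ⟨w, h1, -, h3⟩ := exists_zval_eq_of_lt _ n h
  exact ⟨w, h1, h3⟩

theorem zval_zrep (n : ℕ) : zval (zrep n) = n := by
  obtain ⟨w, h, rfl⟩ := exists_zval_eq n
  obtain ⟨k, hk⟩ := exists_eq_replicate_append_zrep h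
  conv_rhs => rw [hk, zval_replicate_append]

theorem noConsecutiveOnes_zrep (n : ℕ) : NoConsecutiveOnes (zrep n) := by
  obtain ⟨w, h, rfl⟩ := exists_zval_eq n
  obtain ⟨k, hk⟩ := exists_eq_replicate_append_zrep h
  rw [hk] at h
  exact h.of_append_right

theorem zval_lt_fib {w : List (Fin 2)} (h : NoConsecutiveOnes w) :
    zval w < Nat.fib (w.length + 2) := by
  rw [← sum_map_fib_oneIndices]
  refine (isZeckendorfRep_oneIndices h).sum_fib_lt fun a ha => ?_
  rcases List.mem_append.1 (List.mem_of_mem_head? ha) with h1 | h1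
  · exact lt_of_mem_oneIndices h1
  · simp at h1
    omega

theorem fib_length_zrep_le (n : ℕ) (hn : n ≠ 0) : Nat.fib ((zrep n).length + 1) ≤ n := by
  obtain ⟨w, h, rfl⟩ := exists_zval_eq n
  induction w with
  | nil => exact absurd rfl hn
  | cons b w ih =>
    rcases (by fin_cases b <;> simp : b = 0 ∨ b = 1) with rfl | rfl
    · have h0 : zval (0 :: w) = zval w := by simp [zval]
      rw [h0] at hn ⊢
      exact ih (h.of_append_right (u := [0])) hn
    · rw [zrep_zval_one_cons h]
      simp [zval]

theorem length_zrep_mono {m n : ℕ} (h : m ≤ n) : (zrep m).length ≤ (zrep n).length := by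
  by_contra! hlt
  have hm : m ≠ 0 := by
    rintro rfl
    simp [zrep_zero] at hlt
  have h1 := fib_length_zrep_le m hm
  have h2 := zval_lt_fib (noConsecutiveOnes_zrep n)
  rw [zval_zrep] at h2
  have h3 : Nat.fib ((zrep n).length + 2) ≤ Nat.fib ((zrep m).length + 1) :=
    Nat.fib_mono (by omega)
  omega

/-! ### The function `ϕ` -/

theorem phi_zval {w : List (Fin 2)} (h : NoConsecutiveOnes w) : phi (zval w) = zval (w ++ [0]) := by
  obtain ⟨k, hk⟩ := exists_eq_replicate_append_zrep h
  conv_rhs => rw [hk, List.append_assoc, zval_replicate_append]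
  rfl

theorem phi_zero : phi 0 = 0 := by simp [phi, zrep_zero, zval]

theorem zval_append_singleton_eq_phi_add {w : List (Fin 2)} (h : NoConsecutiveOnes w) (b : Fin 2) :
    zval (w ++ [b]) = phi (zval w) + b := by
  rw [zval_append_singleton, phi_zval h]

theorem phi_zval_append_singleton {w : List (Fin 2)} {b : Fin 2} (h : NoConsecutiveOnes (w ++ [b])) :
    phi (zval (w ++ [b])) = phi (zval w) + zval w + 2 * b := by
  rw [phi_zval h, zval_append_append_zero, phi_zval h.of_append_left]

theorem phi_phi (n : ℕ) : phi (phi n) = phi n + n := by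
  have h := phi_zval_append_singleton (noConsecutiveOnes_zrep n).append_zero
  have h2 := zval_append_singleton_eq_phi_add (noConsecutiveOnes_zrep n) 0
  rw [h2, zval_zrep] at h
  simpa using h

open Real in
/-- With `ψ = 1 - φ` the conjugate of the golden ratio `φ`, the number
`[w0]_Z - φ [w]_Z` equals `∑ i, c(w_i) ψ ^ (i + 2)`; this is its recursion. -/
theorem fibSum_conj_append {B : Type*} (c : B → ℤ) (w : List B) (b : B) :
    (fibSum c 1 (w ++ [b]) : ℝ) - goldenRatio * fibSum c 0 (w ++ [b])
      = (1 - goldenRatio) * (fibSum c 1 w - goldenRatio * fibSum c 0 w)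
        + (2 - goldenRatio) * c b := by
  have h := goldenRatio_sq
  rw [fibSum_append_singleton, fibSum_append_singleton, fibSum_add_two]
  simp only [zero_add]
  have f2 : Nat.fib 2 = 1 := rfl
  have f3 : Nat.fib (1 + 2) = 2 := rfl
  rw [f2, f3]
  push_cast
  linear_combination (-(fibSum c 0 w : ℝ)) * h

theorem goldenRatio_gt : 1.618 < Real.goldenRatio := by
  have h : (2.236 : ℝ) < √5 := Real.lt_sqrt_of_sq_lt (by norm_num)
  rw [Real.goldenRatio]
  linarith

theorem goldenRatio_lt : Real.goldenRatio < 1.6181 := by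
  have h : √5 < (2.2362 : ℝ) := (Real.sqrt_lt' (by norm_num)).2 (by norm_num)
  rw [Real.goldenRatio]
  linarith

open Real in
theorem abs_fibSum_conj_le {B : Type*} {c : B → ℤ} (hc : ∀ b, |c b| ≤ 1) (w : List B) :
    |(fibSum c 1 w : ℝ) - goldenRatio * fibSum c 0 w| ≤ 1 := by
  have h1 := goldenRatio_gt
  have h2 := goldenRatio_lt
  induction w using List.reverseRecOn with
  | nil => simp [fibSum]
  | append_singleton w b ih =>
    rw [fibSum_conj_append]
    have hb : |(c b : ℝ)| ≤ 1 := by exact_mod_cast hc b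
    rw [abs_le] at ih hb ⊢
    constructor <;> nlinarith

open Real in
/-- The conjugate of a word without two consecutive digits `1` lies in `(φ - 2, φ - 1)`, and even in
`(φ - 2, 2 φ - 3)` if the last digit is not `1`. -/
theorem fibSum_conj_bounds {w : List (Fin 2)} (h : NoConsecutiveOnes w) :
    goldenRatio - 2 < (fibSum bitVal 1 w : ℝ) - goldenRatio * fibSum bitVal 0 w ∧
      (fibSum bitVal 1 w : ℝ) - goldenRatio * fibSum bitVal 0 w < goldenRatio - 1 ∧
      (w.getLast? ≠ some 1 →
        (fibSum bitVal 1 w : ℝ) - goldenRatio * fibSum bitVal 0 w < 2 * goldenRatio - 3) := by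
  have h1 := goldenRatio_gt
  have h2 := goldenRatio_lt
  have hsq := goldenRatio_sq
  induction w using List.reverseRecOn with
  | nil =>
    simp only [fibSum]
    push_cast
    refine ⟨by linarith, by linarith, fun _ => by linarith⟩
  | append_singleton w b ih =>
    obtain ⟨hw, hb⟩ := noConsecutiveOnes_append_singleton.1 h
    obtain ⟨ih1, ih2, ih3⟩ := ih hw
    rw [fibSum_conj_append]
    generalize (fibSum bitVal 1 w : ℝ) - goldenRatio * fibSum bitVal 0 w = e at *
    rcases (by fin_cases b <;> simp : b = 0 ∨ b = 1) with rfl | rfl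
    · have hv : bitVal 0 = 0 := rfl
      rw [hv]
      push_cast
      refine ⟨by nlinarith, by nlinarith, fun _ => by nlinarith⟩
    · have hv : bitVal 1 = 1 := rfl
      have ih3' := ih3 fun h => hb ⟨h, rfl⟩
      rw [hv]
      push_cast
      refine ⟨by nlinarith, by nlinarith, fun h => by simp at h⟩

open Real in
theorem phi_bounds (n : ℕ) :
    goldenRatio * n + goldenRatio - 2 < phi n ∧ (phi n : ℝ) < goldenRatio * n + goldenRatio - 1 := by
  obtain ⟨h1, h2, -⟩ := fibSum_conj_bounds (noConsecutiveOnes_zrep n)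
  rw [← coe_zval, ← coe_zval_append_zero, zval_zrep] at h1 h2
  have h3 : zval (zrep n ++ [0]) = phi n := rfl
  rw [h3] at h1 h2
  push_cast at h1 h2
  constructor <;> linarith

theorem phi_strictMono : StrictMono phi := by
  refine strictMono_nat_of_lt_succ fun n => ?_
  have h1 := (phi_bounds n).2
  have h2 := (phi_bounds (n + 1)).1
  have h3 := goldenRatio_gt
  have h4 : (phi n : ℝ) - 1 < phi (n + 1) := by
    push_cast at h2
    nlinarith
  have h5 : phi n < phi (n + 1) + 1 := by
    have : (phi n : ℝ) < phi (n + 1) + 1 := by linarith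
    exact_mod_cast this
  have h6 : phi n ≠ phi (n + 1) := by
    intro h
    rw [← h] at h2
    push_cast at h2
    linarith
  omega

theorem phi_injective : Function.Injective phi := phi_strictMono.injective

/-- If `w1` has no two consecutive digits `1`, then its value is not in the image of `ϕ`. -/
theorem phi_ne_zval_append_one {w : List (Fin 2)} (h : NoConsecutiveOnes (w ++ [1])) (r : ℕ) :
    phi r ≠ zval (w ++ [1]) := by
  intro hr
  have h1 : zval (zrep r ++ [0]) = zval (w ++ [1]) := hr
  obtain ⟨k, hk⟩ := exists_eq_replicate_append_zrep h
  obtain ⟨l, hl⟩ := exists_eq_replicate_append_zrep (noConsecutiveOnes_zrep r).append_zero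
  rw [h1] at hl
  -- with enough leading zeros, the two words coincide, but their last digits differ
  have h2 : List.replicate l 0 ++ (w ++ [1]) = List.replicate k 0 ++ (zrep r ++ [0]) := by
    rw [hk, hl, ← List.append_assoc, ← List.append_assoc, ← List.replicate_add,
      ← List.replicate_add, add_comm]
  have h3 := congrArg List.getLast? h2
  simp at h3

/-- Every number is `ϕ(r)` or `ϕ(r) + 1`, according to the last digit of its expansion. -/
theorem exists_eq_phi_add (x : ℕ) : ∃ (r : ℕ),
    (x = phi r ∧ phi x = phi r + r) ∨
      (x = phi r + 1 ∧ phi x = phi r + r + 2 ∧ ∀ s, phi s ≠ x) := by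
  obtain ⟨w, h, rfl⟩ := exists_zval_eq x
  rcases List.eq_nil_or_concat' w with rfl | ⟨v, b, rfl⟩
  · exact ⟨0, Or.inl ⟨by simp [zval, phi_zero], by simp [zval, phi_zero]⟩⟩
  · have h1 := zval_append_singleton_eq_phi_add h.of_append_left b
    have h2 := phi_zval_append_singleton h
    rcases (by fin_cases b <;> simp : b = 0 ∨ b = 1) with rfl | rfl
    · exact ⟨zval v, Or.inl ⟨by simpa using h1, by simpa using h2⟩⟩
    · exact ⟨zval v, Or.inr ⟨by simpa using h1, by simpa using h2, phi_ne_zval_append_one h⟩⟩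

/-! ### Differences of words -/

/-- The integer value of a signed digit. -/
def signVal (t : SignType) : ℤ := t

theorem signVal_digitSub (a b : Fin 2) : signVal (digitSub a b) = bitVal a - bitVal b := by
  fin_cases a <;> fin_cases b <;> simp [signVal, digitSub, bitVal]

theorem fibSum_zipWith_digitSub (s : ℕ) : ∀ (u v : List (Fin 2)), u.length = v.length →
    fibSum signVal s (List.zipWith digitSub u v) = fibSum bitVal s u - fibSum bitVal s v
  | [], [], _ => by simp [fibSum]
  | a :: u, b :: v, h => by
    have h' : u.length = v.length := by simpa using h
    simp only [List.zipWith_cons_cons, fibSum, fibSum_zipWith_digitSub s u v h', signVal_digitSub,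
      List.length_zipWith, h', min_self]
    ring

theorem fibSum_leftpad (s n : ℕ) (u : List (Fin 2)) :
    fibSum bitVal s (u.leftpad n 0) = fibSum bitVal s u := by
  rw [List.leftpad]
  generalize n - u.length = k
  induction k with
  | zero => simp
  | succ k ih => simp [List.replicate_succ, fibSum, ih, bitVal]

theorem fibSum_wordSub (s : ℕ) (u v : List (Fin 2)) :
    fibSum signVal s (wordSub u v) = fibSum bitVal s u - fibSum bitVal s v := by
  rw [wordSub, fibSum_zipWith_digitSub, fibSum_leftpad, fibSum_leftpad]
  simp only [List.leftpad, List.length_append, List.length_replicate]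
  omega

theorem wordSub_append_left (p u v : List (Fin 2)) (h : v.length ≤ u.length) :
    wordSub (p ++ u) v = p.map (digitSub · 0) ++ wordSub u v := by
  have h1 : v.length - (p ++ u).length = 0 := by simp; omega
  have h2 : v.length - u.length = 0 := by omega
  have h3 : (p ++ u).length - v.length = p.length + (u.length - v.length) := by simp; omega
  simp only [wordSub, List.leftpad, h1, h2, h3, List.replicate_zero, List.nil_append,
    List.replicate_add, List.append_assoc]
  rw [List.zipWith_append (by simp)]
  congr 1
  clear h h1 h2 h3
  induction p with
  | nil => rfl
  | cons a p ih => simp [List.replicate_succ, ih]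

theorem wordSub_nil_right (u : List (Fin 2)) : wordSub u [] = u.map (digitSub · 0) := by
  have := wordSub_append_left u [] [] le_rfl
  simpa [wordSub] using this

/-! ### Deterministic automata from congruences -/

theorem DetAutomaton.run_append {S B A : Type*} (D : DetAutomaton S B A) (s : S) (u v : List B) :
    D.run s (u ++ v) = (D.run s u).bind fun t => D.run t v := by
  simp [DetAutomaton.run, List.foldlM_append]

theorem DetAutomaton.run_singleton {S B A : Type*} (D : DetAutomaton S B A) (s : S) (b : B) :
    D.run s [b] = D.step s b := by
  simp [DetAutomaton.run]

theorem DetAutomaton.run_append_singleton {S B A : Type*} (D : DetAutomaton S B A) (s : S)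
    (u : List B) (b : B) : D.run s (u ++ [b]) = (D.run s u).bind fun t => D.step t b := by
  simp [DetAutomaton.run_append, DetAutomaton.run_singleton]

/-- A right congruence `σ` with finitely many classes, on a set of words that is closed under taking
prefixes, is computed by a finite deterministic automaton, whose states are the possible values
of `σ`. -/
theorem exists_detAutomaton_of_congruence {B A X : Type*} [Finite X] (p : List B → Prop)
    (hp : ∀ w b, p (w ++ [b]) → p w) (σ : List B → X) (out : X → A)
    (hσ : ∀ w w' b, p (w ++ [b]) → p (w' ++ [b]) → σ w = σ w' → σ (w ++ [b]) = σ (w' ++ [b])) :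
    ∃ (S : Type) (_ : Fintype S) (D : DetAutomaton S B A) (e : X ≃ S),
      Fintype.card S = Nat.card X ∧ (∀ x, D.out (e x) = out x) ∧ D.start = e (σ []) ∧
        ∀ w, p w → D.run D.start w = some (e (σ w)) := by
  classical
  let e : X ≃ Fin (Nat.card X) := Finite.equivFin X
  let D : DetAutomaton (Fin (Nat.card X)) B A :=
    { step := fun s b =>
        if h : ∃ w, p (w ++ [b]) ∧ e (σ w) = s then some (e (σ (h.choose ++ [b]))) else none
      start := e (σ [])
      out := fun s => out (e.symm s) }
  refine ⟨_, inferInstance, D, e, by simp, fun x => by simp [D], rfl, fun w => ?_⟩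
  induction w using List.reverseRecOn with
  | nil => intro _; simp [DetAutomaton.run, D]
  | append_singleton w b ih =>
    intro hw
    have h : ∃ v, p (v ++ [b]) ∧ e (σ v) = e (σ w) := ⟨w, hw, rfl⟩
    rw [DetAutomaton.run_append_singleton, ih (hp w b hw), Option.bind_some]
    have hs : D.step (e (σ w)) b = some (e (σ (h.choose ++ [b]))) := dif_pos h
    rw [hs, hσ _ _ b h.choose_spec.1 hw (e.injective h.choose_spec.2)]

/-! ### The linearity defect is computed by a finite automaton -/

open Real in
theorem defect_bounds (m n : ℕ) : -1 ≤ defect m n ∧ defect m n ≤ 1 := by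
  have h1 := phi_bounds m
  have h2 := phi_bounds n
  have h3 := phi_bounds (m + n)
  have h4 := goldenRatio_gt
  have h5 := goldenRatio_lt
  push_cast at h3
  have h6 : (-2 : ℝ) < (defect m n : ℤ) := by
    simp only [defect]; push_cast; linarith
  have h7 : ((defect m n : ℤ) : ℝ) < 2 := by
    simp only [defect]; push_cast; linarith
  have h8 : -2 < defect m n := by exact_mod_cast h6
  have h9 : defect m n < 2 := by exact_mod_cast h7
  omega

/-- The signed word `w` and some binary word `z` without two consecutive digits `1` have values that
differ by `a`, the words `w0` and `z0` have values that differ by `c`, and `l` tells whether the last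
digit of `z` is `1`. -/
def ApproximatedBy (w : List SignType) (a c : ℤ) (l : Prop) : Prop :=
  ∃ z : List (Fin 2), NoConsecutiveOnes z ∧ fibSum signVal 0 w - zval z = a ∧
    fibSum signVal 1 w - zval (z ++ [0]) = c ∧ (l ↔ z.getLast? = some 1)

theorem abs_signVal_le (t : SignType) : |signVal t| ≤ 1 := by
  cases t <;> simp [signVal]

open Real in
theorem ApproximatedBy.conj_bounds {w : List SignType} {a c : ℤ} {l : Prop}
    (h : ApproximatedBy w a c l) : -2 ≤ (c : ℝ) - goldenRatio * a ∧ (c : ℝ) - goldenRatio * a ≤ 2 := by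
  obtain ⟨z, hz, rfl, rfl, -⟩ := h
  have h1 := abs_le.1 (abs_fibSum_conj_le abs_signVal_le w)
  obtain ⟨h2, h3, -⟩ := fibSum_conj_bounds hz
  have h4 := goldenRatio_gt
  have h5 := goldenRatio_lt
  rw [coe_zval_append_zero, coe_zval]
  push_cast
  constructor <;> linarith

open Real in
theorem ApproximatedBy.abs_le_fourteen {w : List SignType} {a c : ℤ} {l : Prop}
    (h : ApproximatedBy w a c l) (ha : -7 ≤ a ∧ a ≤ 7) : -14 ≤ c ∧ c ≤ 14 := by
  obtain ⟨h1, h2⟩ := h.conj_bounds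
  have ha1 : (-7 : ℝ) ≤ a := by exact_mod_cast ha.1
  have ha2 : (a : ℝ) ≤ 7 := by exact_mod_cast ha.2
  have h4 := goldenRatio_gt
  have h5 := goldenRatio_lt
  have h6 : (-15 : ℝ) < c := by nlinarith
  have h7 : (c : ℝ) < 15 := by nlinarith
  have h8 : -15 < c := by exact_mod_cast h6
  have h9 : c < 15 := by exact_mod_cast h7
  omega

open Real in
/-- The expanding direction keeps the box: if the difference after reading the next digits is in
`[-7, 7]`, then so is the difference before. -/
theorem ApproximatedBy.abs_le_seven {w : List SignType} {a c : ℤ} {l : Prop}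
    (h : ApproximatedBy w a c l) (hc : -9 ≤ c ∧ c ≤ 9) : -7 ≤ a ∧ a ≤ 7 := by
  obtain ⟨h1, h2⟩ := h.conj_bounds
  have hc1 : (-9 : ℝ) ≤ c := by exact_mod_cast hc.1
  have hc2 : (c : ℝ) ≤ 9 := by exact_mod_cast hc.2
  have h4 := goldenRatio_gt
  have h5 := goldenRatio_lt
  have h6 : (-8 : ℝ) < a := by nlinarith
  have h7 : (a : ℝ) < 8 := by nlinarith
  have h8 : -8 < a := by exact_mod_cast h6
  have h9 : a < 8 := by exact_mod_cast h7
  omega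

theorem ApproximatedBy.append {w : List SignType} {a c : ℤ} {l : Prop} (h : ApproximatedBy w a c l)
    (t : SignType) (b : Fin 2) (hb : ¬(l ∧ b = 1)) :
    ApproximatedBy (w ++ [t]) (c + signVal t - bitVal b)
      (a + c + 2 * signVal t - 2 * bitVal b) (b = 1) := by
  obtain ⟨z, hz, rfl, rfl, hl⟩ := h
  rw [hl] at hb
  refine ⟨z ++ [b], noConsecutiveOnes_append_singleton.2 ⟨hz, hb⟩, ?_, ?_, by simp⟩
  · rw [zval_append_singleton, fibSum_append_singleton]
    simp [bitVal]
    ring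
  · rw [zval_append_append_zero, fibSum_append_singleton, fibSum_add_two]
    simp [bitVal, Nat.fib_add_two]
    ring

theorem ApproximatedBy.exists_of_append {w : List SignType} {t : SignType} {a c : ℤ} {l : Prop}
    (h : ApproximatedBy (w ++ [t]) a c l) : ∃ (a' c' : ℤ) (l' : Prop) (b : Fin 2),
      ApproximatedBy w a' c' l' ∧ ¬(l' ∧ b = 1) ∧ a = c' + signVal t - bitVal b ∧
        c = a' + c' + 2 * signVal t - 2 * bitVal b ∧ (l ↔ b = 1) := by
  obtain ⟨z, hz, rfl, rfl, hl⟩ := h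
  rcases List.eq_nil_or_concat' z with rfl | ⟨z, b, rfl⟩
  · -- the empty word and the word `0` have the same value
    refine ⟨_, _, _, 0, ⟨[], hz, rfl, rfl, Iff.rfl⟩, by simp, ?_, ?_, by simpa using hl⟩
    · rw [fibSum_append_singleton]
      simp [bitVal, zval]
    · rw [fibSum_append_singleton, fibSum_add_two]
      simp [bitVal, zval, Nat.fib_add_two]
      ring
  · obtain ⟨h1, h2⟩ := noConsecutiveOnes_append_singleton.1 hz
    refine ⟨_, _, _, b, ⟨z, h1, rfl, rfl, Iff.rfl⟩, h2, ?_, ?_, by simpa using hl⟩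
    · rw [zval_append_singleton, fibSum_append_singleton]
      simp [bitVal]
      ring
    · rw [zval_append_append_zero, fibSum_append_singleton, fibSum_add_two]
      simp [bitVal, Nat.fib_add_two]
      ring

/-- The finite box of the triples recorded by the automaton for the linearity defect. -/
abbrev DefectBox : Type :=
  Finset.Icc (-7 : ℤ) 7 × Finset.Icc (-14 : ℤ) 14 × Prop

/-- The triples in the box that describe the approximations of `w` by binary words. -/
def approximations (w : List SignType) : Set DefectBox :=
  {x | ApproximatedBy w x.1 x.2.1 x.2.2}

theorem approximations_append_subset {w w' : List SignType}
    (h : approximations w = approximations w') (t : SignType) :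
    approximations (w ++ [t]) ⊆ approximations (w' ++ [t]) := by
  rintro ⟨⟨a, ha⟩, ⟨c, hc⟩, l⟩ hx
  obtain ⟨a', c', l', b, h1, h2, h3, h4, h5⟩ := ApproximatedBy.exists_of_append hx
  dsimp only at h3 h4 h5
  have ha1 := Finset.mem_Icc.1 ha
  have ht := abs_le.1 (abs_signVal_le t)
  have hb : 0 ≤ bitVal b ∧ bitVal b ≤ 1 := by fin_cases b <;> simp [bitVal]
  have ha' := h1.abs_le_seven (by omega)
  have hc' := h1.abs_le_fourteen ha'
  have h6 : ((⟨a', Finset.mem_Icc.2 ha'⟩, ⟨c', Finset.mem_Icc.2 hc'⟩, l') : DefectBox) ∈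
      approximations w := h1
  rw [h] at h6
  have h7 := ApproximatedBy.append h6 t b h2
  change ApproximatedBy (w' ++ [t]) a c l
  rw [h3, h4, propext h5]
  exact h7

/-- If `w` has the value `n ≥ 0`, the approximations of `w` with `a = 0` determine
the difference of the values of `w0` and of `ϕ(n)`. -/
theorem exists_mem_approximations_iff {w : List SignType} {n : ℕ} (hn : fibSum signVal 0 w = n)
    {c : ℤ} : (∃ x ∈ approximations w, (x.1 : ℤ) = 0 ∧ (x.2.1 : ℤ) = c) ↔
      fibSum signVal 1 w - phi n = c ∧ -14 ≤ c ∧ c ≤ 14 := by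
  constructor
  · rintro ⟨⟨⟨a, ha⟩, ⟨c', hc⟩, l⟩, ⟨z, hz, h1, h2, -⟩, h3, h4⟩
    dsimp only at h1 h2 h3 h4
    have h5 : zval z = n := by omega
    rw [← phi_zval hz, h5] at h2
    exact ⟨h2.trans h4, h4 ▸ Finset.mem_Icc.1 hc⟩
  · rintro ⟨h1, h2⟩
    refine ⟨(⟨0, by simp⟩, ⟨c, Finset.mem_Icc.2 h2⟩, (zrep n).getLast? = some 1), ?_, rfl, rfl⟩
    exact ⟨zrep n, noConsecutiveOnes_zrep n, by rw [hn, zval_zrep]; simp, h1, Iff.rfl⟩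

theorem exists_computesDefect : ∃ (Q : Type) (_ : Fintype Q) (D : DetAutomaton Q SignType SignType),
    D.ComputesDefect := by
  classical
  let out : Set DefectBox → SignType := fun X =>
    if h : ∃ c : ℤ, ∃ x ∈ X, (x.1 : ℤ) = 0 ∧ (x.2.1 : ℤ) = c then SignType.sign h.choose else 0
  obtain ⟨Q, hQ, D, e, -, h1, h2, h3⟩ := exists_detAutomaton_of_congruence (fun _ => True)
    (fun _ _ _ => trivial) approximations out fun w w' t _ _ h =>
      (approximations_append_subset h t).antisymm (approximations_append_subset h.symm t)
  refine ⟨Q, hQ, D, ?_, fun m n hmn => ?_⟩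
  · have h4 := h3 [0] trivial
    rw [DetAutomaton.run_singleton] at h4
    have h5 : approximations [0] = approximations [] := by
      simp [approximations, ApproximatedBy, fibSum, signVal]
    rw [h4, h5, h2]
  · set w := wordSub (zrep m) (zrep n) with hw
    have h4 : fibSum signVal 0 w = (m - n : ℕ) := by
      rw [hw, fibSum_wordSub, ← coe_zval, ← coe_zval, zval_zrep, zval_zrep]
      omega
    have h5 : fibSum signVal 1 w - phi (m - n) = defect (m - n) n := by
      rw [hw, fibSum_wordSub, ← coe_zval_append_zero, ← coe_zval_append_zero, defect,
        Nat.sub_add_cancel hmn]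
      simp only [phi]
      ring
    have h6 := defect_bounds (m - n) n
    have h7 : ∃ c : ℤ, ∃ x ∈ approximations w, (x.1 : ℤ) = 0 ∧ (x.2.1 : ℤ) = c :=
      ⟨_, (exists_mem_approximations_iff h4).2 ⟨h5, by omega, by omega⟩⟩
    have h8 := ((exists_mem_approximations_iff h4).1 h7.choose_spec).1
    have h9 : out (approximations w) = SignType.sign (defect (m - n) n) := by
      have : out (approximations w) = SignType.sign h7.choose := dif_pos h7
      rw [this, ← h8, h5]
    rw [DetAutomaton.output, h3 w trivial]
    simp only [Option.map_some, h1, h9]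
    rcases (by omega : defect (m - n) n = -1 ∨ defect (m - n) n = 0 ∨ defect (m - n) n = 1)
      with h | h | h <;> rw [h] <;> simp

variable {R : Type*} [CommRing R]

/-! ### The coefficients of the iterates of `Φ` -/

theorem coeff_phi_Phi (f : PowerSeries R) (n : ℕ) :
    PowerSeries.coeff (phi n) (Phi f) = PowerSeries.coeff n f := by
  have h : {m : ℕ | phi m = phi n} = {n} := by
    ext m
    simp [phi_injective.eq_iff]
  rw [Phi, PowerSeries.coeff_mk, h, finsum_mem_singleton]

theorem coeff_Phi_eq_zero (f : PowerSeries R) {m : ℕ} (h : ∀ n, phi n ≠ m) :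
    PowerSeries.coeff m (Phi f) = 0 := by
  have h' : {n : ℕ | phi n = m} = ∅ := by
    ext n
    simpa using h n
  rw [Phi, PowerSeries.coeff_mk, h', finsum_mem_empty]

theorem coeff_zero_Phi_iterate (f : PowerSeries R) (i : ℕ) :
    PowerSeries.coeff 0 (Phi^[i] f) = PowerSeries.coeff 0 f := by
  induction i with
  | zero => rfl
  | succ i ih =>
    rw [Function.iterate_succ_apply']
    conv_lhs => rw [← phi_zero]
    rw [coeff_phi_Phi, ih]

/-- The coefficient of `x ^ (n - k)` in `Φ^i(f)`, which is `0` if `n - k` is negative. -/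
noncomputable def shiftCoeff (f : PowerSeries R) (i n k : ℕ) : R :=
  if k ≤ n then PowerSeries.coeff (n - k) (Phi^[i] f) else 0

namespace ZMahlerEquation

variable (P : ZMahlerEquation R)

theorem hTilde_gt : (P.height : ℝ) + 4 - 2 * Real.goldenRatio < (Real.goldenRatio - 1) * P.hTilde := by
  have h := Nat.lt_floor_add_one
    (((P.height : ℝ) + 3 - Real.goldenRatio) / (Real.goldenRatio - 1))
  have h1 := goldenRatio_gt
  rw [div_lt_iff₀ (by linarith)] at h
  change _ < ((P.hTilde : ℝ) + 1) * _ at h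
  linarith

theorem one_le_hTilde : 1 ≤ P.hTilde := by
  have h := P.hTilde_gt
  have h1 := goldenRatio_lt
  by_contra! h0
  have h0' : P.hTilde = 0 := by omega
  rw [h0'] at h
  have : (0 : ℝ) ≤ P.height := Nat.cast_nonneg _
  push_cast at h
  linarith

theorem hTilde_add_one_le (h : 1 ≤ P.height) : P.hTilde + 1 ≤ 5 * P.height := by
  have h1 := goldenRatio_gt
  have h2 := goldenRatio_lt
  have h3 : (1 : ℝ) ≤ P.height := by exact_mod_cast h
  have h4 : (P.hTilde : ℝ) ≤ ((P.height : ℝ) + 3 - Real.goldenRatio) / (Real.goldenRatio - 1) :=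
    Nat.floor_le (div_nonneg (by linarith) (by linarith))
  rw [le_div_iff₀ (by linarith)] at h4
  have h5 : (P.hTilde : ℝ) < 4 * P.height := by nlinarith
  have h6 : P.hTilde < 4 * P.height := by exact_mod_cast h5
  omega

/-- The bound `h̃` is large enough: for `ℓ ≤ h̃ + h + 1`, the number `[wb]_Z - ℓ` is in the image of `ϕ`
only if it is `ϕ([w]_Z - j)` for some `j` with `0 ≤ j ≤ h̃`. -/
theorem le_hTilde_of_phi_add_eq {w : List (Fin 2)} {b : Fin 2} (hw : NoConsecutiveOnes (w ++ [b]))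
    {r l : ℕ} (hl : l ≤ P.hTilde + P.height + 1) (h : phi r + l = phi (zval w) + b) :
    r ≤ zval w ∧ zval w - r ≤ P.hTilde := by
  have hr : r ≤ zval w := by
    by_contra! hlt
    have h1 := phi_strictMono hlt
    have hb : b = 1 := by
      by_contra hb
      have : (b : ℕ) = 0 := by omega
      omega
    subst hb
    refine phi_ne_zval_append_one hw r ?_
    rw [zval_append_singleton_eq_phi_add hw.of_append_left]
    simp at h ⊢
    omega
  refine ⟨hr, ?_⟩
  by_contra! hlt
  have h1 := (phi_bounds r).2
  have h2 := (phi_bounds (zval w)).1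
  have h3 := goldenRatio_gt
  have h4 := goldenRatio_lt
  have h5 := P.hTilde_gt
  have h6 : (P.hTilde : ℝ) + 1 ≤ zval w - r := by
    have : P.hTilde + 1 + r ≤ zval w := by omega
    have : (P.hTilde : ℝ) + 1 + r ≤ zval w := by exact_mod_cast this
    linarith
  have h7 : (l : ℝ) ≤ P.hTilde + P.height + 1 := by exact_mod_cast hl
  have h8 : (phi r : ℝ) + l = phi (zval w) + (b : ℕ) := by exact_mod_cast h
  have h9 : (0 : ℝ) ≤ ((b : ℕ) : ℝ) := Nat.cast_nonneg _
  nlinarith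

/-- Reading the digit `b` after `w` and applying `Φ` once more. -/
theorem shiftCoeff_succ (f : PowerSeries R) {w : List (Fin 2)} {b : Fin 2}
    (hw : NoConsecutiveOnes (w ++ [b])) (i : ℕ) {l : ℕ} (hl : l ≤ P.hTilde + P.height + 1) :
    shiftCoeff f (i + 1) (zval (w ++ [b])) l = ∑ j : Fin (P.hTilde + 1),
      if (j : ℕ) ≤ zval w ∧ phi (zval w - j) + l = phi (zval w) + b
        then shiftCoeff f i (zval w) j else 0 := by
  classical
  rw [zval_append_singleton_eq_phi_add hw.of_append_left]
  by_cases h : ∃ r, phi r + l = phi (zval w) + b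
  · obtain ⟨r, hr⟩ := h
    obtain ⟨h1, h2⟩ := P.le_hTilde_of_phi_add_eq hw hl hr
    rw [Finset.sum_eq_single_of_mem (⟨zval w - r, by omega⟩ : Fin (P.hTilde + 1))
      (Finset.mem_univ _)]
    · have h3 : zval w - (zval w - r) = r := by omega
      have h4 : phi (zval w) + b - l = phi r := by omega
      rw [if_pos ⟨by simp, by simpa [h3] using hr⟩, shiftCoeff, if_pos (by omega), h4,
        Function.iterate_succ_apply', coeff_phi_Phi, shiftCoeff, if_pos (by simp), h3]
    · rintro j - hj
      refine if_neg fun ⟨h3, h4⟩ => hj ?_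
      have h5 : zval w - (j : ℕ) = r := phi_injective (by omega)
      ext
      simp only
      omega
  · rw [Finset.sum_eq_zero fun j _ => if_neg fun h3 => h ⟨_, h3.2⟩, shiftCoeff]
    split_ifs with h1
    · rw [Function.iterate_succ_apply', coeff_Phi_eq_zero]
      intro r hr
      exact h ⟨r, by omega⟩
    · rfl

variable {P}

theorem coeff_eq_zero_of_height_lt {i : Fin (P.exponent + 1)} {j : ℕ} (h : P.height < j) :
    (P.coeff i).coeff j = 0 := by
  refine Polynomial.coeff_eq_zero_of_natDegree_lt (lt_of_le_of_lt ?_ h)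
  exact Finset.le_sup (f := fun i => (P.coeff i).natDegree) (Finset.mem_univ i)

/-- The equation, read on coefficients. -/
theorem shiftCoeff_zero_eq (hP : P.IsIsolating) {f : PowerSeries R} (hf : P.IsSolution f) (n k : ℕ) :
    shiftCoeff f 0 n k = ∑ i : Fin P.exponent, ∑ j : Fin (P.height + 1),
      P.alpha (i + 1) j * shiftCoeff f (i + 1) n (k + j) := by
  by_cases hk : k ≤ n
  · have h := congrArg (PowerSeries.coeff (n - k)) hf
    rw [Fin.sum_univ_succ, hP] at h
    simp only [Fin.val_zero, Function.iterate_zero, id, Polynomial.coe_one, one_mul, map_add,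
      map_sum, map_zero] at h
    rw [shiftCoeff, if_pos hk, Function.iterate_zero, id, eq_neg_of_add_eq_zero_left h,
      ← Finset.sum_neg_distrib]
    refine Finset.sum_congr rfl fun i _ => ?_
    have hα : ∀ j, P.alpha (i + 1) j = -(P.coeff i.succ).coeff j := fun j => by
      rw [alpha, dif_pos (by omega)]
      rfl
    rw [PowerSeries.coeff_mul, Finset.Nat.sum_antidiagonal_eq_sum_range_succ_mk,
      ← Finset.sum_neg_distrib]
    have hterm : ∀ j, j ≤ n - k → -((PowerSeries.coeff j) (P.coeff i.succ : PowerSeries R) *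
        (PowerSeries.coeff (n - k - j)) (Phi^[(i.succ : ℕ)] f))
        = P.alpha (i + 1) j * shiftCoeff f (i + 1) n (k + j) := fun j hj => by
      rw [hα, shiftCoeff, if_pos (by omega), Polynomial.coeff_coe, Fin.val_succ, Nat.sub_sub]
      ring
    rw [Finset.sum_congr rfl fun j hj => hterm j (by have := Finset.mem_range.1 hj; omega),
      Fin.sum_univ_eq_sum_range
        (fun j => P.alpha (i + 1) j * shiftCoeff f (i + 1) n (k + j)) (P.height + 1)]
    -- both sums extend to a common range
    have hN : ∀ N, (N = n - k + 1 ∨ N = P.height + 1) →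
        ∑ j ∈ Finset.range N, P.alpha (i + 1) j * shiftCoeff f (i + 1) n (k + j)
        = ∑ j ∈ Finset.range (n - k + 1 + (P.height + 1)),
          P.alpha (i + 1) j * shiftCoeff f (i + 1) n (k + j) := by
      intro N hN
      refine Finset.sum_subset (Finset.range_subset_range.2 (by omega)) fun j _ hj => ?_
      rw [Finset.mem_range, not_lt] at hj
      rcases hN with rfl | rfl
      · rw [shiftCoeff, if_neg (by omega), mul_zero]
      · rw [hα, coeff_eq_zero_of_height_lt (by omega), neg_zero, zero_mul]
    rw [hN _ (Or.inl rfl), hN _ (Or.inr rfl)]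
  · rw [shiftCoeff, if_neg hk]
    refine (Finset.sum_eq_zero fun i _ => Finset.sum_eq_zero fun j _ => ?_).symm
    rw [shiftCoeff, if_neg (by omega), mul_zero]

end ZMahlerEquation

/-! ### Weights of words -/

theorem WeightedAutomaton.weight_nil {S B : Type*} [Fintype S] (A : WeightedAutomaton S B R) :
    A.weight [] = ∑ s, A.init s * A.final s := by
  rw [WeightedAutomaton.weight]
  refine Fintype.sum_equiv (Equiv.funUnique (Fin 1) S) _ _ fun γ => ?_
  simp

/-- Reading the first letter amounts to changing the initial weights. -/
theorem WeightedAutomaton.weight_cons {S B : Type*} [Fintype S] (A : WeightedAutomaton S B R)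
    (b : B) (w : List B) : A.weight (b :: w) =
      { A with init := fun s' => ∑ s, A.init s * A.trans s b s' }.weight w := by
  simp only [WeightedAutomaton.weight]
  rw [← (Fin.consEquiv fun _ : Fin ((b :: w).length + 1) => S).sum_comp, Fintype.sum_prod_type,
    Finset.sum_comm]
  refine Finset.sum_congr rfl fun γ _ => ?_
  rw [Finset.sum_mul, Finset.sum_mul]
  refine Finset.sum_congr rfl fun s _ => ?_
  have h : ∏ k : Fin (b :: w).length, A.trans ((Fin.cons s γ : Fin (w.length + 1 + 1) → S) k.castSucc)
      ((b :: w).get k) ((Fin.cons s γ : Fin (w.length + 1 + 1) → S) k.succ)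
      = A.trans s b (γ 0) * ∏ k : Fin w.length, A.trans (γ k.castSucc) (w.get k) (γ k.succ) :=
    Fin.prod_univ_succ (n := w.length) _
  simp only [Fin.consEquiv_apply]
  rw [h]
  simp only [mul_assoc]
  rfl

/-! ### The last two components of the states -/

/-- After reading `w`, the components of the states that carry a non-zero weight are the last `g`
digits `u` of `0^g w`, and the state `q` that `D` reaches by reading the digits before. -/
def Track {Q : Type*} (D : DetAutomaton Q SignType SignType) (g : ℕ) (w : List (Fin 2)) (q : Q)
    (u : List (Fin 2)) : Prop :=
  ∃ p, List.replicate g 0 ++ w = p ++ u ∧ D.run D.start (p.map (digitSub · 0)) = some q ∧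
    u.length = g

variable {Q : Type*} {D : DetAutomaton Q SignType SignType}

theorem DetAutomaton.ComputesDefect.run_replicate (hD : D.ComputesDefect) (k : ℕ) :
    D.run D.start (List.replicate k 0) = some D.start := by
  induction k with
  | zero => rfl
  | succ k ih =>
    rw [List.replicate_succ', DetAutomaton.run_append_singleton, ih, Option.bind_some, hD.1]

theorem map_digitSub_replicate (k : ℕ) :
    (List.replicate k (0 : Fin 2)).map (digitSub · 0) = List.replicate k 0 := by
  simp [digitSub]

/-- `D` can read every binary word without two consecutive digits `1`. -/
theorem DetAutomaton.ComputesDefect.exists_run (hD : D.ComputesDefect) {w : List (Fin 2)}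
    (hw : NoConsecutiveOnes w) : ∃ q, D.run D.start (w.map (digitSub · 0)) = some q := by
  obtain ⟨k, hk⟩ := exists_eq_replicate_append_zrep hw
  have h := hD.2 (zval w) 0 (Nat.zero_le _)
  rw [zrep_zero, wordSub_nil_right, DetAutomaton.output] at h
  rw [hk, List.map_append, map_digitSub_replicate, DetAutomaton.run_append, hD.run_replicate,
    Option.bind_some]
  cases h' : D.run D.start ((zrep (zval w)).map (digitSub · 0)) with
  | none => simp [h'] at h
  | some q => exact ⟨q, rfl⟩

theorem exists_track (hD : D.ComputesDefect) (g : ℕ) {w : List (Fin 2)} (hw : NoConsecutiveOnes w) :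
    ∃ q u, Track D g w q u := by
  set v := List.replicate g 0 ++ w with hv
  have h1 := List.take_append_drop w.length v
  have h2 : NoConsecutiveOnes (v.take w.length ++ v.drop w.length) := by
    rw [h1]
    exact hw.replicate_append g
  obtain ⟨q, hq⟩ := hD.exists_run h2.of_append_left
  exact ⟨q, v.drop w.length, v.take w.length, h1.symm, hq, by simp [hv]⟩

theorem Track.unique {g : ℕ} {w u u' : List (Fin 2)} {q q' : Q} (h : Track D g w q u)
    (h' : Track D g w q' u') : q = q' ∧ u = u' := by
  obtain ⟨p, h1, h2, h3⟩ := h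
  obtain ⟨p', h1', h2', h3'⟩ := h'
  obtain ⟨rfl, rfl⟩ := List.append_inj' (h1.symm.trans h1') (h3.trans h3'.symm)
  exact ⟨Option.some.inj (h2.symm.trans h2'), rfl⟩

theorem track_nil_iff {g : ℕ} {q : Q} {u : List (Fin 2)} :
    Track D g [] q u ↔ q = D.start ∧ u = List.replicate g 0 := by
  have h : Track D g [] D.start (List.replicate g 0) := ⟨[], by simp, rfl, by simp⟩
  constructor
  · exact fun h' => h'.unique h
  · rintro ⟨rfl, rfl⟩
    exact h

theorem Track.append {g : ℕ} {w u : List (Fin 2)} {a b : Fin 2} {q q' : Q}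
    (h : Track D g w q (a :: u)) (hq : D.step q (digitSub a 0) = some q') :
    Track D g (w ++ [b]) q' (u ++ [b]) := by
  obtain ⟨p, h1, h2, h3⟩ := h
  refine ⟨p ++ [a], ?_, ?_, by simpa using h3⟩
  · rw [← List.append_assoc, h1]
    simp
  · rw [List.map_append, List.map_singleton, DetAutomaton.run_append_singleton, h2,
      Option.bind_some, hq]

/-- The tracked state reads the difference of `[w]_Z` and `j`, if `j` has at most `g` digits. -/
theorem Track.output_wordSub (hD : D.ComputesDefect) {g : ℕ} {w u : List (Fin 2)} {q : Q}
    (hw : NoConsecutiveOnes w) (h : Track D g w q u) {j : ℕ} (hj : j ≤ zval w)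
    (hg : (zrep j).length ≤ g) :
    (D.output q (wordSub u (zrep j))).map (fun e : SignType => (e : ℤ))
      = some (defect (zval w - j) j) := by
  obtain ⟨p, h1, h2, h3⟩ := h
  obtain ⟨k, hk⟩ := exists_eq_replicate_append_zrep hw
  have h4 : D.output q (wordSub u (zrep j)) = D.output D.start (wordSub (p ++ u) (zrep j)) := by
    rw [wordSub_append_left _ _ _ (by omega), DetAutomaton.output, DetAutomaton.output,
      DetAutomaton.run_append, h2, Option.bind_some]
  have h5 : D.output D.start (wordSub (p ++ u) (zrep j))
      = D.output D.start (wordSub (zrep (zval w)) (zrep j)) := by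
    rw [← h1, hk, ← List.append_assoc, ← List.replicate_add, zval_replicate_append, zval_zrep,
      wordSub_append_left _ _ _ (length_zrep_mono hj), map_digitSub_replicate,
      DetAutomaton.output, DetAutomaton.output, DetAutomaton.run_append, hD.run_replicate,
      Option.bind_some]
  rw [h4, h5]
  exact hD.2 _ _ hj

namespace ZMahlerEquation

variable (P : ZMahlerEquation R)

theorem gLen_pos : 0 < P.gLen := by
  rw [gLen, List.length_pos_iff]
  intro h
  have h1 := zval_zrep P.hTilde
  rw [h] at h1
  have := P.one_le_hTilde
  simp [zval] at h1
  omega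

variable {P}

theorem shift_iff_track (hD : D.ComputesDefect) {w : List (Fin 2)} {b : Fin 2}
    (hw : NoConsecutiveOnes (w ++ [b])) {s : P.State Q}
    (hs : Track D P.gLen w s.2.2.1 s.2.2.2.toList) (s' : P.State Q) :
    P.Shift D s b s' ↔ Track D P.gLen (w ++ [b]) s'.2.2.1 s'.2.2.2.toList := by
  constructor
  · rintro ⟨a, u, h1, h2, h3⟩
    rw [h2]
    rw [h1] at hs
    exact hs.append h3
  · intro h
    cases hu : s.2.2.2.toList with
    | nil =>
      have h1 : s.2.2.2.toList.length = P.gLen := List.Vector.toList_length _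
      have h2 := P.gLen_pos
      rw [hu] at h1
      simp at h1
      omega
    | cons a u =>
      rw [hu] at hs
      have hs' := hs
      obtain ⟨p, h1, h2, -⟩ := hs'
      have h3 : NoConsecutiveOnes (p ++ [a]) := by
        have h4 := hw.of_append_left.replicate_append P.gLen
        rw [h1, show p ++ a :: u = (p ++ [a]) ++ u by simp] at h4
        exact h4.of_append_left
      obtain ⟨q, hq⟩ := hD.exists_run h3
      rw [List.map_append, List.map_singleton, DetAutomaton.run_append_singleton, h2,
        Option.bind_some] at hq
      obtain ⟨h5, h6⟩ := h.unique (hs.append (b := b) hq)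
      exact ⟨a, u, hu, h6, by rw [hq, h5]⟩

open Classical in
/-- The transition weights out of a tracked state, with `δ̂` replaced by the linearity defect. -/
theorem transWeight_of_track (hD : D.ComputesDefect) {w : List (Fin 2)} {b : Fin 2}
    (hw : NoConsecutiveOnes (w ++ [b])) {s : P.State Q}
    (hs : Track D P.gLen w s.2.2.1 s.2.2.2.toList) (hj : (s.2.1 : ℕ) ≤ zval w) {s' : P.State Q}
    (hs' : Track D P.gLen (w ++ [b]) s'.2.2.1 s'.2.2.2.toList) :
    P.transWeight D s b s' =
      if (s'.1 : ℕ) = s.1 + 1 ∧ phi (zval w - s.2.1) + s'.2.1 = phi (zval w) + b then 1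
      else if (s.1 : ℕ) < P.exponent ∧ (s'.1 : ℕ) = 0 then
        ∑ j : Fin (P.height + 1),
          if phi (zval w - s.2.1) + (s'.2.1 + j) = phi (zval w) + b then P.alpha (s.1 + 1) j else 0
      else 0 := by
  have hg : (zrep s.2.1).length ≤ P.gLen := length_zrep_mono (by omega)
  have h1 := hs.output_wordSub hD hw.of_append_left hj hg
  rw [transWeight, deltaHat]
  cases he : D.output s.2.2.1 (wordSub s.2.2.2.toList (zrep s.2.1)) with
  | none => simp [he] at h1
  | some e =>
    rw [he, Option.map_some, Option.some.injEq, defect, Nat.sub_add_cancel hj] at h1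
    simp only [if_pos ((shift_iff_track hD hw hs s').2 hs')]
    rw [h1]
    have hl : (phi (s.2.1 : ℕ) : ℤ) + ((phi (zval w) : ℤ) - phi (zval w - s.2.1) - phi s.2.1)
        + ((b : ℕ) : ℤ) = phi (zval w) + (b : ℕ) - phi (zval w - s.2.1) := by ring
    rw [hl]
    refine if_congr (and_congr Iff.rfl (by omega)) rfl ?_
    by_cases h2 : (s.1 : ℕ) < P.exponent ∧ (s'.1 : ℕ) = 0
    · rw [if_pos h2]
      set x : ℤ := phi (zval w) + (b : ℕ) - phi (zval w - s.2.1) - ((s'.2.1 : ℕ) : ℤ) with hx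
      by_cases h3 : 0 ≤ x ∧ x ≤ P.height
      · rw [if_pos ⟨h2.1, h2.2, h3⟩, Finset.sum_eq_single_of_mem
          (⟨x.toNat, by omega⟩ : Fin (P.height + 1)) (Finset.mem_univ _)]
        · rw [if_pos]
          simp only
          omega
        · intro j _ hj'
          refine if_neg fun h4 => hj' ?_
          ext
          simp only
          omega
      · rw [if_neg fun h => h3 h.2.2]
        refine (Finset.sum_eq_zero fun j _ => if_neg fun h4 => h3 ?_).symm
        omega
    · rw [if_neg h2, if_neg fun h => h2 ⟨h.1, h.2.1⟩]

open Classical in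
/-- The weight of the paths that end in a given state after reading `w`. -/
noncomputable def stateWeight (P : ZMahlerEquation R) (D : DetAutomaton Q SignType SignType)
    (f : PowerSeries R) (w : List (Fin 2)) (s : P.State Q) : R :=
  if Track D P.gLen w s.2.2.1 s.2.2.2.toList then shiftCoeff f s.1 (zval w) s.2.1 else 0

/-- Only the states with the tracked last two components contribute to a sum over all states. -/
theorem sum_stateWeight_mul [Fintype Q] {f : PowerSeries R}
    {w : List (Fin 2)} {q : Q} {u : List.Vector (Fin 2) P.gLen}
    (hu : Track D P.gLen w q u.toList) (F : P.State Q → R) :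
    ∑ s, P.stateWeight D f w s * F s
      = ∑ i : Fin (P.exponent + 1), ∑ j : Fin (P.hTilde + 1),
        shiftCoeff f i (zval w) j * F (i, j, q, u) := by
  classical
  rw [Fintype.sum_prod_type]
  refine Finset.sum_congr rfl fun i _ => ?_
  rw [Fintype.sum_prod_type]
  refine Finset.sum_congr rfl fun j _ => ?_
  rw [Finset.sum_eq_single_of_mem (q, u) (Finset.mem_univ _)]
  · rw [stateWeight, if_pos hu]
  · rintro ⟨q', u'⟩ - hne
    rw [stateWeight, if_neg, zero_mul]
    intro h
    obtain ⟨rfl, h2⟩ := h.unique hu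
    exact hne (Prod.ext rfl (List.Vector.toList_injective h2))

theorem exists_track_vector (hD : D.ComputesDefect) {w : List (Fin 2)} (hw : NoConsecutiveOnes w) :
    ∃ (q : Q) (u : List.Vector (Fin 2) P.gLen), Track D P.gLen w q u.toList := by
  obtain ⟨q, u, h⟩ := exists_track hD P.gLen hw
  have h' := h
  obtain ⟨p, -, -, h3⟩ := h'
  exact ⟨q, ⟨u, h3⟩, h⟩

/-- One step of the recursion: reading the digit `b` turns the weights after `w` into those
after `wb`. -/
theorem sum_stateWeight_mul_trans [Fintype Q] (hP : P.IsIsolating) (hD : D.ComputesDefect)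
    {f : PowerSeries R} (hf : P.IsSolution f) {w : List (Fin 2)} {b : Fin 2}
    (hw : NoConsecutiveOnes (w ++ [b])) (s' : P.State Q) :
    ∑ s, P.stateWeight D f w s * P.transWeight D s b s' = P.stateWeight D f (w ++ [b]) s' := by
  classical
  obtain ⟨q, u, hu⟩ := exists_track_vector (P := P) hD hw.of_append_left
  rw [sum_stateWeight_mul hu fun s => P.transWeight D s b s', stateWeight]
  split_ifs with hs'
  swap
  · refine Finset.sum_eq_zero fun i _ => Finset.sum_eq_zero fun j _ => ?_
    rw [transWeight]
    have h : ¬ P.Shift D (i, j, q, u) b s' := fun h => hs' ((shift_iff_track hD hw hu s').1 h)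
    simp only [if_neg h]
    split <;> simp
  have hterm : ∀ (i : Fin (P.exponent + 1)) (j : Fin (P.hTilde + 1)),
      shiftCoeff f i (zval w) j * P.transWeight D (i, j, q, u) b s' =
      if (j : ℕ) ≤ zval w then shiftCoeff f i (zval w) j *
        (if (s'.1 : ℕ) = i + 1 ∧ phi (zval w - j) + s'.2.1 = phi (zval w) + b then 1
        else if (i : ℕ) < P.exponent ∧ (s'.1 : ℕ) = 0 then
          ∑ k : Fin (P.height + 1),
            if phi (zval w - j) + (s'.2.1 + k) = phi (zval w) + b then P.alpha (i + 1) k else 0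
        else 0) else 0 := by
    intro i j
    by_cases hj : (j : ℕ) ≤ zval w
    · rw [if_pos hj, transWeight_of_track hD hw (s := (i, j, q, u)) hu hj hs']
    · rw [if_neg hj, shiftCoeff, if_neg hj, zero_mul]
  simp_rw [hterm]
  obtain ⟨⟨i', hi'⟩, k, q', u'⟩ := s'
  simp only
  rcases Nat.eq_zero_or_pos i' with rfl | hpos
  · rw [shiftCoeff_zero_eq hP hf, Fin.sum_univ_castSucc]
    -- the states with `i = d` have no transitions to the states with `i = 0`
    have hlast : ∑ j : Fin (P.hTilde + 1), (if (j : ℕ) ≤ zval w then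
        shiftCoeff f (Fin.last P.exponent) (zval w) j *
        (if 0 = ((Fin.last P.exponent : Fin (P.exponent + 1)) : ℕ) + 1 ∧
            phi (zval w - j) + k = phi (zval w) + b then 1
        else if ((Fin.last P.exponent : Fin (P.exponent + 1)) : ℕ) < P.exponent ∧ 0 = 0 then
          ∑ x : Fin (P.height + 1), if phi (zval w - j) + (k + x) = phi (zval w) + b
            then P.alpha ((Fin.last P.exponent : Fin (P.exponent + 1)) + 1) x else 0
        else 0) else 0) = 0 := by
      refine Finset.sum_eq_zero fun j _ => ?_
      simp
    rw [hlast, add_zero]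
    refine Finset.sum_congr rfl fun i _ => ?_
    have hR : ∀ x : Fin (P.height + 1),
        P.alpha (i + 1) x * shiftCoeff f (i + 1) (zval (w ++ [b])) (k + x)
        = ∑ j : Fin (P.hTilde + 1), P.alpha (i + 1) x *
          if (j : ℕ) ≤ zval w ∧ phi (zval w - j) + (k + x) = phi (zval w) + b
            then shiftCoeff f i (zval w) j else 0 := fun x => by
      rw [P.shiftCoeff_succ f hw i (by omega), Finset.mul_sum]
    simp_rw [hR]
    rw [Finset.sum_comm]
    refine Finset.sum_congr rfl fun j _ => ?_
    by_cases hj : (j : ℕ) ≤ zval w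
    · simp only [hj, if_true, true_and, Fin.val_castSucc, i.isLt, and_self]
      rw [if_neg (by omega), Finset.mul_sum]
      refine Finset.sum_congr rfl fun x _ => ?_
      split_ifs <;> ring
    · simp [hj]
  · obtain ⟨i, rfl⟩ : ∃ i, i' = i + 1 := ⟨i' - 1, by omega⟩
    rw [P.shiftCoeff_succ f hw i (by omega), Finset.sum_eq_single_of_mem
      (⟨i, by omega⟩ : Fin (P.exponent + 1)) (Finset.mem_univ _)]
    · refine Finset.sum_congr rfl fun j _ => ?_
      by_cases hj : (j : ℕ) ≤ zval w <;> simp [hj]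
    · intro x _ hx
      refine Finset.sum_eq_zero fun j _ => ?_
      have hx' : i ≠ x := fun h => hx (Fin.ext h.symm)
      simp [hx']

theorem stateWeight_nil (f : PowerSeries R) (s : P.State Q) :
    P.stateWeight D f [] s = (P.automaton D (PowerSeries.coeff 0 f)).init s := by
  classical
  simp only [stateWeight, automaton, track_nil_iff, shiftCoeff, zval]
  by_cases h : (s.2.1 : ℕ) = 0
  · simp [h, coeff_zero_Phi_iterate]
  · simp [h]

/-- The automaton computes the coefficients of the solution. -/
theorem weight_automaton [Fintype Q] (hP : P.IsIsolating) (hD : D.ComputesDefect)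
    {f : PowerSeries R} (hf : P.IsSolution f) {w : List (Fin 2)} (hw : NoConsecutiveOnes w) :
    (P.automaton D (PowerSeries.coeff 0 f)).weight w = PowerSeries.coeff (zval w) f := by
  classical
  set A := P.automaton D (PowerSeries.coeff 0 f) with hA
  have key : ∀ v u : List (Fin 2), NoConsecutiveOnes (u ++ v) →
      WeightedAutomaton.weight { A with init := P.stateWeight D f u } v
        = PowerSeries.coeff (zval (u ++ v)) f := by
    intro v
    induction v with
    | nil =>
      intro u hu
      rw [List.append_nil] at hu ⊢
      obtain ⟨q, x, hx⟩ := exists_track_vector (P := P) hD hu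
      rw [WeightedAutomaton.weight_nil]
      simp only
      rw [sum_stateWeight_mul hx A.final, Finset.sum_eq_single_of_mem 0 (Finset.mem_univ _),
        Finset.sum_eq_single_of_mem 0 (Finset.mem_univ _)]
      · simp [hA, automaton, shiftCoeff]
      · intro j _ hj
        simp [hA, automaton, hj]
      · intro i _ hi
        exact Finset.sum_eq_zero fun j _ => by simp [hA, automaton, hi]
    | cons b v ih =>
      intro u hu
      have hu' : NoConsecutiveOnes ((u ++ [b]) ++ v) := by simpa using hu
      have h : (fun s' => ∑ s, P.stateWeight D f u s * A.trans s b s')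
          = P.stateWeight D f (u ++ [b]) :=
        funext fun s' => sum_stateWeight_mul_trans hP hD hf hu'.of_append_left s'
      rw [WeightedAutomaton.weight_cons]
      simp only
      rw [h, ih _ hu']
      simp
  have h0 : { A with init := P.stateWeight D f [] } = A := by
    have : P.stateWeight D f [] = A.init := funext fun s => stateWeight_nil f s
    rw [this]
  have h1 := key w [] hw
  rw [h0] at h1
  exact h1

theorem isZRegular_of_isSolution (hP : P.IsIsolating) {f : PowerSeries R} (hf : P.IsSolution f) :
    IsZRegular f := by
  obtain ⟨Q, _, D, hD⟩ := exists_computesDefect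
  refine ⟨P.State Q, inferInstance, P.automaton D (PowerSeries.coeff 0 f), fun n => ?_⟩
  rw [weight_automaton hP hD hf (noConsecutiveOnes_zrep n), zval_zrep]

end ZMahlerEquation

namespace ZMahlerEquation

variable (P : ZMahlerEquation R)

/-! ### Deterministic automata over finite rings -/

/-- The graph of the function `j ↦ ϕ(n) - ϕ(n - j)`, for `j ≤ min(h̃, n)`. -/
def gapPairs (n : ℕ) : Set (Fin (P.hTilde + 1) × Fin (2 * P.hTilde + 1)) :=
  {x | (x.1 : ℕ) ≤ n ∧ phi (n - x.1) + x.2 = phi n}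

theorem phi_le_phi_sub_add {n j : ℕ} (hj : j ≤ n) : phi n ≤ phi (n - j) + 2 * j := by
  have h1 := (phi_bounds n).2
  have h2 := (phi_bounds (n - j)).1
  have h3 := goldenRatio_lt
  rw [Nat.cast_sub hj] at h2
  have h4 : (0 : ℝ) ≤ j := Nat.cast_nonneg j
  have h5 : (phi n : ℝ) < phi (n - j) + 2 * j + 1 := by nlinarith
  have h6 : phi n < phi (n - j) + 2 * j + 1 := by exact_mod_cast h5
  omega

variable {P}

theorem gap_of_gapPairs_eq {n m : ℕ} (h : P.gapPairs n = P.gapPairs m) {j x y : ℕ}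
    (hj : j ≤ P.hTilde) (hn : j ≤ n ∧ phi (n - j) + x = phi n + y) :
    j ≤ m ∧ phi (m - j) + x = phi m + y := by
  have h1 := phi_le_phi_sub_add hn.1
  have h2 : phi (n - j) ≤ phi n := phi_strictMono.monotone (Nat.sub_le n j)
  have h3 : ((⟨j, by omega⟩, ⟨phi n - phi (n - j), by omega⟩) :
      Fin (P.hTilde + 1) × Fin (2 * P.hTilde + 1)) ∈ P.gapPairs n := ⟨hn.1, by simp only; omega⟩
  rw [h] at h3
  obtain ⟨h4, h5⟩ := h3
  simp only at h4 h5
  exact ⟨h4, by omega⟩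

/-- The differences `ϕ(n) - ϕ(n - j)` for `[wb]_Z` are determined by those for `[w]_Z`: a number
`[wb]_Z - k` is either `ϕ([w]_Z - j)` or `ϕ([w]_Z - j) + 1`, and the old differences tell which. -/
theorem gapPairs_append_subset {w w' : List (Fin 2)} {b : Fin 2} (hw : NoConsecutiveOnes (w ++ [b]))
    (hw' : NoConsecutiveOnes (w' ++ [b])) (h : P.gapPairs (zval w) = P.gapPairs (zval w')) :
    P.gapPairs (zval (w ++ [b])) ⊆ P.gapPairs (zval (w' ++ [b])) := by
  rintro ⟨⟨k, hk⟩, x⟩ ⟨h1, h2⟩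
  simp only at h1 h2
  change k ≤ zval (w' ++ [b]) ∧ phi (zval (w' ++ [b]) - k) + x = phi (zval (w' ++ [b]))
  rw [phi_zval_append_singleton hw] at h2
  rw [phi_zval_append_singleton hw']
  rw [zval_append_singleton_eq_phi_add hw.of_append_left] at h1 h2
  rw [zval_append_singleton_eq_phi_add hw'.of_append_left]
  obtain ⟨r, ⟨h3, h4⟩ | ⟨h3, h4, h5⟩⟩ := exists_eq_phi_add (phi (zval w) + b - k)
  · obtain ⟨h6, h7⟩ := P.le_hTilde_of_phi_add_eq hw (r := r) (l := k) (by omega) (by omega)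
    have h8 : zval w - (zval w - r) = r := by omega
    obtain ⟨h9, h10⟩ := gap_of_gapPairs_eq h (x := k) (y := b) h7 ⟨by omega, by rw [h8]; omega⟩
    have h11 : phi (zval w') + b - k = phi (zval w' - (zval w - r)) := by omega
    rw [h11, phi_phi]
    omega
  · -- here the value of `ϕ` is hit by the index `k + 1`, which may be `h̃ + 1`
    obtain ⟨h6, h7⟩ := P.le_hTilde_of_phi_add_eq hw (r := r) (l := k + 1) (by omega) (by omega)
    have h8 : zval w - (zval w - r) = r := by omega
    obtain ⟨h9, h10⟩ := gap_of_gapPairs_eq h (x := k + 1) (y := b) h7 ⟨by omega, by rw [h8]; omega⟩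
    obtain ⟨s, ⟨h11, h12⟩ | ⟨h11, h12, -⟩⟩ := exists_eq_phi_add (phi (zval w') + b - k)
    · -- a value of `ϕ` at this place would also be one below `[wb]_Z`
      exfalso
      obtain ⟨h13, h14⟩ := P.le_hTilde_of_phi_add_eq hw' (r := s) (l := k) (by omega) (by omega)
      have h15 : zval w' - (zval w' - s) = s := by omega
      obtain ⟨h16, h17⟩ := gap_of_gapPairs_eq h.symm (x := k) (y := b) h14
        ⟨by omega, by rw [h15]; omega⟩
      exact h5 (zval w - (zval w' - s)) (by omega)
    · have h13 : s = zval w' - (zval w - r) := phi_injective (by omega)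
      rw [h12, h13]
      omega

/-- The information about the word `w` that determines the coefficients of `f` at the words
extending `w`. -/
noncomputable def profile (P : ZMahlerEquation R) (f : PowerSeries R) (w : List (Fin 2)) :
    Set (Fin (P.hTilde + 1) × Fin (2 * P.hTilde + 1)) ×
      (Fin P.exponent → Fin (P.hTilde + 1) → R) :=
  (P.gapPairs (zval w), fun i j => shiftCoeff f i (zval w) j)

theorem profile_append_eq (hP : P.IsIsolating) {f : PowerSeries R} (hf : P.IsSolution f)
    {w w' : List (Fin 2)} {b : Fin 2} (hw : NoConsecutiveOnes (w ++ [b]))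
    (hw' : NoConsecutiveOnes (w' ++ [b])) (h : P.profile f w = P.profile f w') :
    P.profile f (w ++ [b]) = P.profile f (w' ++ [b]) := by
  classical
  obtain ⟨h1, h2⟩ := Prod.mk.inj h
  have h3 : ∀ (i : Fin P.exponent) (l : ℕ), l ≤ P.hTilde + P.height + 1 →
      shiftCoeff f (i + 1) (zval (w ++ [b])) l = shiftCoeff f (i + 1) (zval (w' ++ [b])) l := by
    intro i l hl
    rw [P.shiftCoeff_succ f hw i hl, P.shiftCoeff_succ f hw' i hl]
    refine Finset.sum_congr rfl fun j _ => if_congr ?_ (congrFun (congrFun h2 i) j) rfl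
    exact ⟨gap_of_gapPairs_eq h1 (by omega), gap_of_gapPairs_eq h1.symm (by omega)⟩
  refine Prod.ext ((gapPairs_append_subset hw hw' h1).antisymm
    (gapPairs_append_subset hw' hw h1.symm)) (funext fun i => funext fun j => ?_)
  obtain ⟨i, hi⟩ := i
  cases i with
  | zero =>
    change shiftCoeff f 0 _ _ = shiftCoeff f 0 _ _
    rw [shiftCoeff_zero_eq hP hf, shiftCoeff_zero_eq hP hf]
    exact Finset.sum_congr rfl fun i _ => Finset.sum_congr rfl fun x _ => by
      rw [h3 i _ (by omega)]
  | succ i => exact h3 ⟨i, by omega⟩ j (by omega)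

theorem card_profile_le [Finite R] [Nontrivial R] (hd : 1 ≤ P.exponent) (hh : 1 ≤ P.height) :
    Nat.card (Set (Fin (P.hTilde + 1) × Fin (2 * P.hTilde + 1)) ×
      (Fin P.exponent → Fin (P.hTilde + 1) → R))
      ≤ Nat.card R ^ (320 * P.exponent * P.height ^ 2) := by
  have hR : 2 ≤ Nat.card R := Finite.one_lt_card
  have hH := P.hTilde_add_one_le hh
  rw [Nat.card_prod, Nat.card_fun, Nat.card_fun, Nat.card_eq_fintype_card, Fintype.card_set,
    Fintype.card_prod]
  simp only [Fintype.card_fin, Nat.card_eq_fintype_card (α := Fin _)]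
  calc _ ≤ Nat.card R ^ ((P.hTilde + 1) * (2 * P.hTilde + 1)) *
        (Nat.card R ^ (P.hTilde + 1)) ^ P.exponent :=
        Nat.mul_le_mul_right _ (Nat.pow_le_pow_left hR _)
    _ = Nat.card R ^ ((P.hTilde + 1) * (2 * P.hTilde + 1) + (P.hTilde + 1) * P.exponent) := by
        rw [← pow_mul, ← pow_add]
    _ ≤ _ := by
        refine Nat.pow_le_pow_right (by omega) ?_
        generalize P.hTilde = H at *
        generalize P.height = h at *
        generalize P.exponent = d at *
        have h1 : (H + 1) * (2 * H + 1) ≤ (5 * h) * (10 * h) := Nat.mul_le_mul hH (by omega)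
        have h2 : (H + 1) * d ≤ (5 * h) * d := Nat.mul_le_mul_right _ hH
        have h3 : h ^ 2 ≤ d * h ^ 2 := Nat.le_mul_of_pos_left _ hd
        have h4 : h * d ≤ d * h ^ 2 := by
          rw [mul_comm h d, sq]
          exact Nat.mul_le_mul_left _ (Nat.le_mul_of_pos_left _ hh)
        have h5 : (5 * h) * (10 * h) = 50 * h ^ 2 := by ring
        have h6 : 320 * d * h ^ 2 = 320 * (d * h ^ 2) := by ring
        have h7 : (5 * h) * d = 5 * (h * d) := by ring
        omega

theorem eq_zero_of_exponent_eq_zero (hP : P.IsIsolating) {f : PowerSeries R} (hf : P.IsSolution f)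
    (hd : P.exponent = 0) : f = 0 := by
  ext n
  have h := shiftCoeff_zero_eq hP hf n 0
  have : IsEmpty (Fin P.exponent) := by
    rw [hd]
    infer_instance
  rw [Finset.univ_eq_empty, Finset.sum_empty] at h
  simpa [shiftCoeff] using h

theorem exists_detAutomaton_zero : ∃ (S : Type) (_ : Fintype S) (A : DetAutomaton S (Fin 2) R),
    A.Generates 0 ∧ Fintype.card S = 1 := by
  obtain ⟨S, hS, A, e, h1, h2, -, h3⟩ := exists_detAutomaton_of_congruence (B := Fin 2)
    (fun _ => True) (fun _ _ _ => trivial) (fun _ => ()) (fun _ => (0 : R))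
    (fun _ _ _ _ _ _ => rfl)
  exact ⟨S, hS, A, fun n => by simp [DetAutomaton.output, h3 _ trivial, h2], by simp [h1]⟩

theorem exists_detAutomaton_generates [Finite R] (hP : P.IsIsolating) {f : PowerSeries R}
    (hf : P.IsSolution f) (hh : 1 ≤ P.height) :
    ∃ (S : Type) (_ : Fintype S) (A : DetAutomaton S (Fin 2) R),
      A.Generates f ∧ Fintype.card S ≤ Nat.card R ^ (320 * P.exponent * P.height ^ 2) := by
  by_cases h0 : f = 0
  · obtain ⟨S, hS, A, h1, h2⟩ := exists_detAutomaton_zero (R := R)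
    exact ⟨S, hS, A, h0 ▸ h1, h2 ▸ Nat.one_le_pow _ _ Nat.card_pos⟩
  have hd : 1 ≤ P.exponent := by
    by_contra! hd
    exact h0 (eq_zero_of_exponent_eq_zero hP hf (by omega))
  have hR : Nontrivial R := by
    by_contra hR
    rw [not_nontrivial_iff_subsingleton] at hR
    exact h0 (PowerSeries.ext fun n => Subsingleton.elim _ _)
  obtain ⟨S, hS, A, e, h1, h2, -, h3⟩ := exists_detAutomaton_of_congruence NoConsecutiveOnes
    (fun _ _ h => h.of_append_left) (P.profile f) (fun x => x.2 ⟨0, hd⟩ 0)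
    (fun _ _ _ hw hw' h => profile_append_eq hP hf hw hw' h)
  refine ⟨S, hS, A, fun n => ?_, h1 ▸ card_profile_le hd hh⟩
  rw [DetAutomaton.output, h3 _ (noConsecutiveOnes_zrep n), Option.map_some, h2]
  simp [profile, shiftCoeff, zval_zrep]

end ZMahlerEquation

end ZMahler

theorem theorem3 {R : Type*} [CommRing R] (P : ZMahler.ZMahlerEquation R) (hP : P.IsIsolating) :
    -- some finite deterministic automaton computes the linearity defect
    (∃ (Q : Type) (_ : Fintype Q) (D : ZMahler.DetAutomaton Q SignType SignType),
      D.ComputesDefect) ∧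
    ∀ f : PowerSeries R, P.IsSolution f →
      -- whichever such automaton is used, the associated weighted automaton computes `f`
      (∀ (Q : Type*) [Fintype Q] (D : ZMahler.DetAutomaton Q SignType SignType),
        D.ComputesDefect → ∀ w : List (Fin 2), ZMahler.NoConsecutiveOnes w →
          (P.automaton D (PowerSeries.coeff 0 f)).weight w
            = PowerSeries.coeff (ZMahler.zval w) f) ∧
      ZMahler.IsZRegular f ∧
      (Finite R → 1 ≤ P.height →
        ∃ (S : Type) (_ : Fintype S) (A : ZMahler.DetAutomaton S (Fin 2) R),
          A.Generates f ∧
          Fintype.card S ≤ Nat.card R ^ (320 * P.exponent * P.height ^ 2)) := by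
  refine ⟨ZMahler.exists_computesDefect, fun f hf => ⟨?_, ?_, ?_⟩⟩
  · intro Q _ D hD w hw
    exact ZMahler.ZMahlerEquation.weight_automaton hP hD hf hw
  · exact ZMahler.ZMahlerEquation.isZRegular_of_isSolution hP hf
  · intro _ hh
    exact ZMahler.ZMahlerEquation.exists_detAutomaton_generates hP hf hh
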